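/- Let $\Gamma$ be a groupoid with set of objects $\Gamma_0$; for a morphism $\gamma$ write $d(\gamma)$ and $r(\gamma)$ for its domain and range, so that $\sigma\tau$ is defined iff $d(\sigma)=r(\tau)$. Rings are associative, not necessarily unital. A $\Gamma$-graded ring is a ring $R=\bigoplus_{\gamma\in\Gamma}R_\gamma$ with $R_\gamma R_\delta\subseteq R_{\gamma\delta}$ (where $R_{\gamma\delta}:=0$ if $\gamma\delta$ is not defined) that is object unital: for each $e\in\Gamma_0$ there is $1_e\in R_e$ with $1_{r(\gamma)}a=a=a1_{d(\gamma)}$ for all $a\in R_\gamma$. Put $\operatorname{supp}R=\{\gamma: R_\gamma\ne 0\}$. Write $R\cong_{gr}S$ if there is a ring isomorphism $\varphi:R\to S$ with $\varphi(R_\gamma)\subseteq S_\gamma$ for all $\gamma\in\Gamma$ and $\varphi(1_e)=1_e$ for all $e\in\Gamma_0$. A $\Gamma$-graded ring $D\neq0$ is a gr-division ring if each nonzero $a\in D_\gamma$ ($\gamma\in\Gamma$) has some $b\in D_{\gamma^{-1}}$ with $ab=1_{r(\gamma)}$, $ba=1_{d(\gamma)}$; $R\ne0$ is gr-simple if its only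 graded two-sided ideals are $0$ and $R$. A family $\bar\sigma=(\sigma_i)_{i\in I}$ in $\Gamma$, with $I\ne\emptyset$, is $d$-finite if $\{i: d(\sigma_i)=f\}$ is finite for each $f\in\Gamma_0$. For such a family, $M_I(D)(\bar\sigma)=\bigoplus_{\gamma}M_I(D)(\bar\sigma)_\gamma$ is the $\Gamma$-graded ring, with the usual matrix product, where $M_I(D)(\bar\sigma)_\gamma$ consists of the $I\times I$ matrices $(a_{ij})$ with finitely many nonzero entries and $a_{ij}\in D_{\sigma_i\gamma\sigma_j^{-1}}$ for all $i,j$; $M_1(D)(\tau^{-1})$ is the case of a one-element family. The graded product $\prod^{gr}_{j\in J}R_j$ is the $\Gamma$-graded ring with components $\prod_j(R_j)_\gamma$; the family $(R_j)_{j\in J}$ is summable if $\prod^{gr}_jR_j=\bigoplus_jR_j$. **Theorem.** (1) Let $e,e'\in\Gamma_0$, let $D,D'$ be $\Gamma$-graded division rings with $\operatorname{supp}D\subseteq e\Gamma e$, $\operatorname{supp}D'\subseteq e'\Gamma e'$, and let $\bar\sigma=(\sigma_i)_{i\in I}\in(e\Gamma)^I$, $\bar\delta=(\delta_i)_{i\in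 I'}\in(e'\Gamma)^{I'}$ be $d$-finite, with $I,I'$ nonempty. Then $M_I(D)(\bar\sigma)\cong_{gr}M_{I'}(D')(\bar\delta)$ if and only if there are a bijection $\pi:I\to I'$ and $\tau\in e'\Gamma e$ such that $D'\cong_{gr}M_1(D)(\tau^{-1})$ and $\delta_{\pi(i)}\in\tau(\operatorname{supp}D)\sigma_i$ for all $i\in I$. (2) Let $(R_j)_{j\in J}$ and $(T_j)_{j\in J'}$ be summable families of gr-simple $\Gamma$-graded rings. Then $\prod^{gr}_{j\in J}R_j\cong_{gr}\prod^{gr}_{j\in J'}T_j$ if and only if there is a bijection $\pi:J\to J'$ with $R_j\cong_{gr}T_{\pi(j)}$ for all $j\in J$. (3) (Uniqueness of the Wedderburn–Artin decomposition.) For each $j\in J$ let $e_j\in\Gamma_0$, let $D_j$ be a $\Gamma$-graded division ring with $\operatorname{supp}D_j\subseteq e_j\Gamma e_j$, and let $\bar\sigma_j=(\sigma_{jk})_{k\in K_j}\in(e_j\Gamma)^{K_j}$ be $d$-finite with $K_j\neq\emptyset$, such that the family $(M_{K_j}(D_j)(\bar\sigma_j))_{j\in J}$ is summable; let $e'_j$,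 $D'_j$, $\bar\delta_j=(\delta_{jk})_{k\in K'_j}$ $(j\in J')$ be data of the same kind. Then $\prod^{gr}_{j\in J}M_{K_j}(D_j)(\bar\sigma_j)\cong_{gr}\prod^{gr}_{j\in J'}M_{K'_j}(D'_j)(\bar\delta_j)$ if and only if there is a bijection $\pi:J\to J'$ and, for each $j\in J$, a bijection $\varpi_j:K_j\to K'_{\pi(j)}$ and $\tau_j\in e'_{\pi(j)}\Gamma e_j$ such that $D'_{\pi(j)}\cong_{gr}M_1(D_j)(\tau_j^{-1})$ and $\delta_{\pi(j)\varpi_j(k)}\in\tau_j(\operatorname{supp}D_j)\sigma_{jk}$ for all $k\in K_j$. -/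

import Mathlib

open CategoryTheory

/-! ## Elements of a groupoid

A groupoid `Γ` is given as a category `C` with `[Groupoid C]`, so `Γ₀ = C`; its elements are the
morphisms `γ : d(γ) ⟶ r(γ)` of `C`.  The product `στ` means "first `τ`, then `σ`", and it is
defined exactly when `d(σ) = r(τ)`. -/

namespace GroupoidGraded

section Arrows

/-- The set `Γ` of elements (morphisms) of the groupoid, with their domain `d` and range `r`. -/
structure Arr (C : Type*) [Groupoid C] where
  d : C
  r : C
  hom : d ⟶ r

variable {C : Type*} [Groupoid C]

/-- The element of `Γ` given by the object `e` (the identity morphism of `e`). -/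
def idArr (e : C) : Arr C := ⟨e, e, 𝟙 e⟩

/-- The inverse `γ⁻¹` of an element of the groupoid. -/
def invArr (γ : Arr C) : Arr C := ⟨γ.r, γ.d, Groupoid.inv γ.hom⟩

open Classical in
/-- The partial product `στ` (`none` when it is not defined). -/
noncomputable def pmul (σ τ : Arr C) : Option (Arr C) :=
  if h : τ.r = σ.d then some ⟨τ.d, σ.r, τ.hom ≫ eqToHom h ≫ σ.hom⟩ else none

/-- The partial product `σ γ τ`. -/
noncomputable def pmul₃ (σ γ τ : Arr C) : Option (Arr C) :=
  (pmul σ γ).bind fun ρ => pmul ρ τ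

theorem pmul_eq_none {σ τ : Arr C} (h : τ.r ≠ σ.d) : pmul σ τ = none := by
  simp [pmul, h]

theorem pmul_mk {x y z : C} (g : y ⟶ z) (f : x ⟶ y) :
    pmul ⟨y, z, g⟩ ⟨x, y, f⟩ = some ⟨x, z, f ≫ g⟩ := by
  simp [pmul]

theorem pmul₃_mk {w x y z : C} (h : y ⟶ z) (g : x ⟶ y) (f : w ⟶ x) :
    pmul₃ ⟨y, z, h⟩ ⟨x, y, g⟩ ⟨w, x, f⟩ = some ⟨w, z, f ≫ g ≫ h⟩ := by
  simp [pmul₃, pmul_mk]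

theorem pmul₃_eq_none {σ γ τ : Arr C} (h : ¬ (γ.r = σ.d ∧ τ.r = γ.d)) :
    pmul₃ σ γ τ = none := by
  by_cases h1 : γ.r = σ.d
  · have h2 : τ.r ≠ γ.d := fun h2 => h ⟨h1, h2⟩
    simp [pmul₃, pmul, h1, h2]
  · simp [pmul₃, pmul, h1]

theorem pmul₃_eq_some {σ γ τ ρ : Arr C} (h : pmul₃ σ γ τ = some ρ) : γ.r = σ.d ∧ τ.r = γ.d := by
  by_contra h'
  rw [pmul₃_eq_none h'] at h
  cases h

/-- `σ γ τ⁻¹` determines `γ`, once `σ` and `τ` are given. -/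
theorem pmul₃_inj {σ τ γ δ ρ : Arr C} (hγ : pmul₃ σ γ (invArr τ) = some ρ)
    (hδ : pmul₃ σ δ (invArr τ) = some ρ) : γ = δ := by
  obtain ⟨h1, h1'⟩ := pmul₃_eq_some hγ
  obtain ⟨h2, h2'⟩ := pmul₃_eq_some hδ
  obtain ⟨x, y, g⟩ := γ
  obtain ⟨x', y', g'⟩ := δ
  obtain ⟨a, b, s⟩ := σ
  obtain ⟨c, d, t⟩ := τ
  simp only [invArr] at h1 h1' h2 h2' hγ hδ
  subst h1; subst h1'; subst h2; subst h2'
  have e1 := hγ.trans hδ.symm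
  rw [pmul₃_mk, pmul₃_mk, Option.some.injEq] at e1
  have e2 : Groupoid.inv t ≫ g ≫ s = Groupoid.inv t ≫ g' ≫ s := by
    injection e1
  have e3 : g ≫ s = g' ≫ s := by
    have := congrArg (fun u => t ≫ u) e2
    simpa using this
  have e4 : g = g' := by
    have := congrArg (fun u => u ≫ Groupoid.inv s) e3
    simpa using this
  rw [e4]

end Arrows

/-! ## Graded rings

Rings are associative, not necessarily unital. -/

/-- The homogeneous component attached to a possibly undefined product; it is `0` if the product is
not defined. -/
def compAt {A R : Type*} [AddGroup R] (comp : A → AddSubgroup R) (o : Option A) : AddSubgroup R :=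
  o.elim ⊥ comp

open Classical in
/-- An object unital grading of the ring `R` by the groupoid `Γ`: `R = ⊕ R_γ`,
`R_γ R_δ ⊆ R_{γδ}` (which is `0` when `γδ` is not defined), together with elements `1_e ∈ R_e`
with `1_{r(γ)} a = a = a 1_{d(γ)}` for `a ∈ R_γ`. -/
structure GroupoidGrading (C : Type*) [Groupoid C] (R : Type*) [NonUnitalRing R] where
  comp : Arr C → AddSubgroup R
  isInternal : DirectSum.IsInternal comp
  mul_mem : ∀ {γ δ : Arr C} {a b : R}, a ∈ comp γ → b ∈ comp δ → a * b ∈ compAt comp (pmul γ δ)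
  one : C → R
  one_mem : ∀ e, one e ∈ comp (idArr e)
  one_mul : ∀ {γ : Arr C} {a : R}, a ∈ comp γ → one γ.r * a = a
  mul_one : ∀ {γ : Arr C} {a : R}, a ∈ comp γ → a * one γ.d = a

namespace GroupoidGrading

variable {C : Type*} [Groupoid C] {R S : Type*} [NonUnitalRing R] [NonUnitalRing S]

/-- The support of a graded ring. -/
def supp (𝓡 : GroupoidGrading C R) : Set (Arr C) := {γ | 𝓡.comp γ ≠ ⊥}

/-- `supp R ⊆ e Γ e`. -/
def SupportedAt (𝓡 : GroupoidGrading C R) (e : C) : Prop :=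
  ∀ γ ∈ 𝓡.supp, γ.r = e ∧ γ.d = e

/-- A graded division ring: it is nonzero and each nonzero homogeneous `a ∈ R_γ` has an inverse in
`R_{γ⁻¹}`. -/
def IsGrDivision (𝓡 : GroupoidGrading C R) : Prop :=
  (∃ a : R, a ≠ 0) ∧
    ∀ (γ : Arr C) (a : R), a ∈ 𝓡.comp γ → a ≠ 0 →
      ∃ b ∈ 𝓡.comp (invArr γ), a * b = 𝓡.one γ.r ∧ b * a = 𝓡.one γ.d

/-- `N` is a graded (two-sided) ideal. -/
def IsGradedIdeal (𝓡 : GroupoidGrading C R) (N : AddSubgroup R) : Prop :=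
  (∀ r : R, ∀ x ∈ N, r * x ∈ N ∧ x * r ∈ N) ∧ N = ⨆ γ, N ⊓ 𝓡.comp γ

/-- A gr-simple ring: it is nonzero and its only graded ideals are `0` and the whole ring. -/
def IsGrSimple (𝓡 : GroupoidGrading C R) : Prop :=
  (∃ a : R, a ≠ 0) ∧ ∀ N : AddSubgroup R, 𝓡.IsGradedIdeal N → N = ⊥ ∨ N = ⊤

/-- `R ≅_gr S`: there is a bijective ring homomorphism that preserves the homogeneous components and
sends `1_e` to `1_e` for each `e ∈ Γ₀`. -/
def GrIso (𝓡 : GroupoidGrading C R) (𝓢 : GroupoidGrading C S) : Prop :=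
  ∃ φ : R ≃+* S, (∀ (γ : Arr C), ∀ a ∈ 𝓡.comp γ, φ a ∈ 𝓢.comp γ) ∧
    ∀ e : C, φ (𝓡.one e) = 𝓢.one e

theorem indep (𝓡 : GroupoidGrading C R) : iSupIndep 𝓡.comp := by
  classical
  have h := 𝓡.isInternal
  apply DirectSum.IsInternal.addSubgroup_iSupIndep
  convert h

end GroupoidGrading

/-! ## The graded subring spanned by given independent components -/

/-- An independent family of additive subgroups of a ring `S` satisfying all the axioms of an object
unital grading, except that it need not span `S`. -/
structure PreGrading (C : Type*) [Groupoid C] (S : Type*) [NonUnitalRing S] where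
  comp : Arr C → AddSubgroup S
  indep : iSupIndep comp
  mul_mem : ∀ {γ δ : Arr C} {a b : S}, a ∈ comp γ → b ∈ comp δ → a * b ∈ compAt comp (pmul γ δ)
  one : C → S
  one_mem : ∀ e, one e ∈ comp (idArr e)
  one_mul : ∀ {γ : Arr C} {a : S}, a ∈ comp γ → one γ.r * a = a
  mul_one : ∀ {γ : Arr C} {a : S}, a ∈ comp γ → a * one γ.d = a

namespace PreGrading

variable {C : Type*} [Groupoid C] {S : Type*} [NonUnitalRing S]

theorem compAt_le (𝓢 : PreGrading C S) (o : Option (Arr C)) : compAt 𝓢.comp o ≤ ⨆ γ, 𝓢.comp γ := by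
  cases o with
  | none => exact bot_le
  | some γ => exact le_iSup 𝓢.comp γ

/-- The subring `⊕ S_γ` of `S`. -/
def subring (𝓢 : PreGrading C S) : NonUnitalSubring S where
  carrier := ((⨆ γ, 𝓢.comp γ : AddSubgroup S) : Set S)
  zero_mem' := zero_mem _
  add_mem' := add_mem
  neg_mem' := neg_mem
  mul_mem' := by
    intro a b ha hb
    change a * b ∈ (⨆ γ, 𝓢.comp γ : AddSubgroup S)
    have ha' : a ∈ (⨆ γ, 𝓢.comp γ : AddSubgroup S) := ha
    have hb' : b ∈ (⨆ γ, 𝓢.comp γ : AddSubgroup S) := hb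
    refine AddSubgroup.iSup_induction 𝓢.comp (C := fun a => a * b ∈ _) ha' ?_ ?_ ?_
    · intro γ x hx
      refine AddSubgroup.iSup_induction 𝓢.comp (C := fun b => x * b ∈ _) hb' ?_ ?_ ?_
      · intro δ y hy
        exact 𝓢.compAt_le _ (𝓢.mul_mem hx hy)
      · simp
      · intro y z hy hz
        rw [mul_add]
        exact add_mem hy hz
    · simp
    · intro y z hy hz
      rw [add_mul]
      exact add_mem hy hz

theorem mem_subring (𝓢 : PreGrading C S) {a : S} :
    a ∈ 𝓢.subring ↔ a ∈ (⨆ γ, 𝓢.comp γ : AddSubgroup S) := Iff.rfl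

theorem comp_le (𝓢 : PreGrading C S) {γ : Arr C} {a : S} (ha : a ∈ 𝓢.comp γ) : a ∈ 𝓢.subring :=
  𝓢.mem_subring.2 (le_iSup 𝓢.comp γ ha)

/-- The homogeneous components of the subring `⊕ S_γ`. -/
def subComp (𝓢 : PreGrading C S) (γ : Arr C) : AddSubgroup 𝓢.subring where
  carrier := {a | (a : S) ∈ 𝓢.comp γ}
  zero_mem' := zero_mem (𝓢.comp γ)
  add_mem' := fun ha hb => add_mem (S := AddSubgroup S) ha hb
  neg_mem' := fun ha => neg_mem (S := AddSubgroup S) ha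

theorem subComp_indep (𝓢 : PreGrading C S) : iSupIndep 𝓢.subComp := by
  intro γ
  rw [AddSubgroup.disjoint_def]
  intro x hx hx'
  have h := 𝓢.indep γ
  rw [AddSubgroup.disjoint_def] at h
  have key : (⨆ δ, ⨆ (_ : δ ≠ γ), 𝓢.subComp δ) ≤
      (⨆ δ, ⨆ (_ : δ ≠ γ), 𝓢.comp δ).comap
        (NonUnitalSubringClass.subtype 𝓢.subring : 𝓢.subring →+ S) := by
    refine iSup_le fun δ => iSup_le fun hδ => ?_
    intro y hy
    exact (le_iSup₂ (f := fun δ (_ : δ ≠ γ) => 𝓢.comp δ) δ hδ) hy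
  exact Subtype.ext (h hx (key hx'))

theorem subComp_iSup (𝓢 : PreGrading C S) : ⨆ γ, 𝓢.subComp γ = ⊤ := by
  rw [eq_top_iff]
  rintro ⟨x, hx⟩ -
  have hx' : x ∈ (⨆ γ, 𝓢.comp γ : AddSubgroup S) := hx
  refine AddSubgroup.iSup_induction' 𝓢.comp
    (C := fun a ha => (⟨a, ha⟩ : 𝓢.subring) ∈ ⨆ γ, 𝓢.subComp γ) ?_ ?_ ?_ hx'
  · intro γ a ha
    exact le_iSup 𝓢.subComp γ (show a ∈ 𝓢.comp γ from ha)
  · exact zero_mem (⨆ γ, 𝓢.subComp γ)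
  · intro a b ha hb h1 h2
    exact add_mem h1 h2

open Classical in
theorem subComp_isInternal (𝓢 : PreGrading C S) : DirectSum.IsInternal 𝓢.subComp := by
  constructor
  · exact 𝓢.subComp_indep.dfinsuppSumAddHom_injective
  · have h := 𝓢.subComp_iSup
    intro x
    have hx : x ∈ ⨆ γ, 𝓢.subComp γ := by rw [h]; trivial
    refine AddSubgroup.iSup_induction 𝓢.subComp
      (C := fun x => ∃ a, (DirectSum.coeAddMonoidHom 𝓢.subComp) a = x) hx ?_ ?_ ?_
    · intro γ y hy
      exact ⟨DirectSum.of (fun γ => 𝓢.subComp γ) γ ⟨y, hy⟩, by simp⟩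
    · exact ⟨0, map_zero _⟩
    · rintro y z ⟨a, rfl⟩ ⟨b, rfl⟩
      exact ⟨a + b, map_add _ _ _⟩

/-- The ring `⊕ S_γ` is a graded ring. -/
def toGrading (𝓢 : PreGrading C S) : GroupoidGrading C 𝓢.subring where
  comp := 𝓢.subComp
  isInternal := 𝓢.subComp_isInternal
  mul_mem := by
    intro γ δ a b ha hb
    have h := 𝓢.mul_mem (show (a : S) ∈ 𝓢.comp γ from ha) (show (b : S) ∈ 𝓢.comp δ from hb)
    cases hp : pmul γ δ with
    | none =>
      rw [hp] at h
      have h0 : (a : S) * b = 0 := h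
      exact Subtype.ext h0
    | some ρ =>
      rw [hp] at h
      exact h
  one := fun e => ⟨𝓢.one e, 𝓢.comp_le (𝓢.one_mem e)⟩
  one_mem := fun e => 𝓢.one_mem e
  one_mul := fun ha => Subtype.ext (𝓢.one_mul ha)
  mul_one := fun ha => Subtype.ext (𝓢.mul_one ha)

end PreGrading

/-! ## Graded direct products -/

section Product

variable {C : Type*} [Groupoid C] {J : Type*} {R : J → Type*} [∀ j, NonUnitalRing (R j)]

/-- The components `∏_j (R_j)_γ`, inside `∏_j R_j`. -/
def prodPreGrading (𝓡 : ∀ j, GroupoidGrading C (R j)) : PreGrading C (∀ j, R j) where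
  comp := fun γ => AddSubgroup.pi Set.univ fun j => (𝓡 j).comp γ
  indep := by
    intro γ
    rw [AddSubgroup.disjoint_def]
    intro x hx hx'
    funext j
    have h := (𝓡 j).indep γ
    rw [AddSubgroup.disjoint_def] at h
    have key : (⨆ δ, ⨆ (_ : δ ≠ γ), AddSubgroup.pi Set.univ fun j => (𝓡 j).comp δ) ≤
        (⨆ δ, ⨆ (_ : δ ≠ γ), (𝓡 j).comp δ).comap (Pi.evalAddMonoidHom R j) := by
      refine iSup_le fun δ => iSup_le fun hδ => ?_
      intro y hy
      exact (le_iSup₂ (f := fun δ (_ : δ ≠ γ) => (𝓡 j).comp δ) δ hδ) (hy j trivial)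
    exact h (hx j trivial) (key hx')
  mul_mem := by
    intro γ δ a b ha hb
    have h := fun j => (𝓡 j).mul_mem (ha j trivial) (hb j trivial)
    cases hp : pmul γ δ with
    | none =>
      simp only [hp] at h
      exact funext h
    | some ρ =>
      simp only [hp] at h
      exact fun j _ => h j
  one := fun e j => (𝓡 j).one e
  one_mem := fun e j _ => (𝓡 j).one_mem e
  one_mul := fun ha => funext fun j => (𝓡 j).one_mul (ha j trivial)
  mul_one := fun ha => funext fun j => (𝓡 j).mul_one (ha j trivial)

/-- The underlying ring of the graded direct product, `⊕_γ ∏_j (R_j)_γ`, realized inside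
`∏_j R_j`. -/
abbrev GrProd (𝓡 : ∀ j, GroupoidGrading C (R j)) : NonUnitalSubring (∀ j, R j) :=
  (prodPreGrading 𝓡).subring

/-- The graded direct product. -/
def grProd (𝓡 : ∀ j, GroupoidGrading C (R j)) : GroupoidGrading C (GrProd 𝓡) :=
  (prodPreGrading 𝓡).toGrading

/-- The family is summable: its graded direct product is the direct sum, that is, each element of
the graded direct product has only finitely many nonzero coordinates. -/
def IsSummable (𝓡 : ∀ j, GroupoidGrading C (R j)) : Prop :=
  ∀ f ∈ GrProd 𝓡, {j | f j ≠ 0}.Finite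

end Product

/-! ## Matrices with finitely many nonzero entries -/

section FinMatrix

/-- The `I × I` matrices over `R` with finitely many nonzero entries. -/
def FinMatrix (I R : Type*) [NonUnitalRing R] : AddSubgroup (Matrix I I R) where
  carrier := {A | {p : I × I | A p.1 p.2 ≠ 0}.Finite}
  zero_mem' := by simp
  add_mem' := by
    intro A B hA hB
    refine (Set.Finite.union hA hB).subset ?_
    intro p hp
    by_contra h
    simp only [Set.mem_union, Set.mem_ofPred_eq, not_or, not_not] at h
    exact hp (by simp [h.1, h.2])
  neg_mem' := by
    intro A hA
    simpa using hA

variable {I R : Type*} [NonUnitalRing R]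

theorem finMatrix_exists_finset (A : FinMatrix I R) :
    ∃ s : Finset I, ∀ i j, (A : Matrix I I R) i j ≠ 0 → i ∈ s ∧ j ∈ s := by
  classical
  have hA : {p : I × I | (A : Matrix I I R) p.1 p.2 ≠ 0}.Finite := A.2
  refine ⟨hA.toFinset.image Prod.fst ∪ hA.toFinset.image Prod.snd, fun i j h => ?_⟩
  have hm : (i, j) ∈ hA.toFinset := hA.mem_toFinset.2 h
  exact ⟨Finset.mem_union_left _ (Finset.mem_image_of_mem Prod.fst hm),
    Finset.mem_union_right _ (Finset.mem_image_of_mem Prod.snd hm)⟩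

theorem finsum_eq_of_left (A B : Matrix I I R) (s : Finset I)
    (hs : ∀ i j, A i j ≠ 0 → i ∈ s ∧ j ∈ s) (i j : I) :
    ∑ᶠ k, A i k * B k j = ∑ k ∈ s, A i k * B k j := by
  apply finsum_eq_sum_of_support_subset
  intro k hk
  by_contra h
  have : A i k = 0 := by
    by_contra h'
    exact h (hs i k h').2
  exact hk (by simp [this])

theorem exists_of_finsum_ne_zero {f : I → R} (h : ∑ᶠ k, f k ≠ 0) : ∃ k, f k ≠ 0 := by
  by_contra h'
  push Not at h'
  exact h (finsum_eq_zero_of_forall_eq_zero h')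

/-- The usual product of matrices. -/
noncomputable instance : Mul (FinMatrix I R) where
  mul A B := ⟨fun i j => ∑ᶠ k, (A : Matrix I I R) i k * (B : Matrix I I R) k j, by
    obtain ⟨s, hs⟩ := finMatrix_exists_finset A
    obtain ⟨t, ht⟩ := finMatrix_exists_finset B
    refine (s ×ˢ t).finite_toSet.subset ?_
    rintro ⟨i, j⟩ hij
    simp only [Set.mem_ofPred_eq] at hij
    obtain ⟨k, hk⟩ := exists_of_finsum_ne_zero hij
    have h1 : (A : Matrix I I R) i k ≠ 0 := left_ne_zero_of_mul hk
    have h2 : (B : Matrix I I R) k j ≠ 0 := right_ne_zero_of_mul hk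
    simpa using ⟨(hs _ _ h1).1, (ht _ _ h2).2⟩⟩

theorem finMatrix_mul_apply (A B : FinMatrix I R) (i j : I) :
    ((A * B : FinMatrix I R) : Matrix I I R) i j
      = ∑ᶠ k, (A : Matrix I I R) i k * (B : Matrix I I R) k j := rfl

theorem finMatrix_mul_eq (A B : FinMatrix I R) (s : Finset I)
    (hs : ∀ i j, (A : Matrix I I R) i j ≠ 0 → i ∈ s ∧ j ∈ s) (i j : I) :
    ((A * B : FinMatrix I R) : Matrix I I R) i j
      = ∑ k ∈ s, (A : Matrix I I R) i k * (B : Matrix I I R) k j :=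
  finsum_eq_of_left _ _ s hs i j

theorem finMatrix_ext {A B : FinMatrix I R}
    (h : ∀ i j, (A : Matrix I I R) i j = (B : Matrix I I R) i j) : A = B :=
  Subtype.ext (Matrix.ext h)

theorem finMatrix_exists_finset₂ (A B : FinMatrix I R) :
    ∃ s : Finset I, (∀ i j, (A : Matrix I I R) i j ≠ 0 → i ∈ s ∧ j ∈ s) ∧
      ∀ i j, (B : Matrix I I R) i j ≠ 0 → i ∈ s ∧ j ∈ s := by
  classical
  obtain ⟨s, hs⟩ := finMatrix_exists_finset A
  obtain ⟨t, ht⟩ := finMatrix_exists_finset B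
  exact ⟨s ∪ t, fun i j h => ⟨Finset.mem_union_left _ (hs i j h).1,
    Finset.mem_union_left _ (hs i j h).2⟩, fun i j h => ⟨Finset.mem_union_right _ (ht i j h).1,
    Finset.mem_union_right _ (ht i j h).2⟩⟩

theorem finMatrix_add_apply (A B : FinMatrix I R) (i j : I) :
    ((A + B : FinMatrix I R) : Matrix I I R) i j
      = (A : Matrix I I R) i j + (B : Matrix I I R) i j := rfl

theorem finMatrix_zero_apply (i j : I) :
    ((0 : FinMatrix I R) : Matrix I I R) i j = 0 := rfl

/-- The matrices with finitely many nonzero entries form a (non-unital) ring. -/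
noncomputable instance : NonUnitalRing (FinMatrix I R) where
  left_distrib A B D := by
    obtain ⟨s, hs⟩ := finMatrix_exists_finset A
    apply finMatrix_ext
    intro i j
    rw [finMatrix_add_apply, finMatrix_mul_eq A _ s hs, finMatrix_mul_eq A _ s hs,
      finMatrix_mul_eq A _ s hs, ← Finset.sum_add_distrib]
    exact Finset.sum_congr rfl fun k _ => by rw [finMatrix_add_apply, mul_add]
  right_distrib A B D := by
    obtain ⟨s, hA, hB⟩ := finMatrix_exists_finset₂ A B
    have hAB : ∀ i j, ((A + B : FinMatrix I R) : Matrix I I R) i j ≠ 0 → i ∈ s ∧ j ∈ s := by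
      intro i j h
      by_cases h' : (A : Matrix I I R) i j = 0
      · refine hB i j fun h'' => h ?_
        rw [finMatrix_add_apply, h', h'', add_zero]
      · exact hA i j h'
    apply finMatrix_ext
    intro i j
    rw [finMatrix_add_apply, finMatrix_mul_eq _ _ s hAB, finMatrix_mul_eq A _ s hA,
      finMatrix_mul_eq B _ s hB, ← Finset.sum_add_distrib]
    exact Finset.sum_congr rfl fun k _ => by rw [finMatrix_add_apply, add_mul]
  zero_mul A := by
    apply finMatrix_ext
    intro i j
    simp [finMatrix_mul_apply]
  mul_zero A := by
    apply finMatrix_ext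
    intro i j
    simp [finMatrix_mul_apply]
  mul_assoc A B D := by
    obtain ⟨s, hA, hB⟩ := finMatrix_exists_finset₂ A B
    have hAB : ∀ i j, ((A * B : FinMatrix I R) : Matrix I I R) i j ≠ 0 → i ∈ s ∧ j ∈ s := by
      intro i j h
      obtain ⟨k, hk⟩ := exists_of_finsum_ne_zero h
      exact ⟨(hA _ _ (left_ne_zero_of_mul hk)).1, (hB _ _ (right_ne_zero_of_mul hk)).2⟩
    apply finMatrix_ext
    intro i j
    rw [finMatrix_mul_eq _ _ s hAB, finMatrix_mul_eq A _ s hA]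
    simp_rw [finMatrix_mul_eq A _ s hA, finMatrix_mul_eq B _ s hB, Finset.sum_mul, Finset.mul_sum,
      mul_assoc]
    exact Finset.sum_comm

end FinMatrix

/-! ## Graded matrix rings -/

section GradedMatrix

variable {C : Type*} [Groupoid C] {I R : Type*} [NonUnitalRing R]

/-- The sequence `(σ_i)` in `Γ` is `d`-finite: for each `e ∈ Γ₀`, only finitely many `i` satisfy
`d(σ_i) = e`. -/
def DFinite (σ : I → Arr C) : Prop := ∀ e : C, {i | (σ i).d = e}.Finite

theorem DFinite.of_finite [Finite I] (σ : I → Arr C) : DFinite σ := fun _ => Set.toFinite _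

/-- `M_I(R)(σ)_γ`: the matrices `(a_ij)` with finitely many nonzero entries such that
`a_ij ∈ R_{σ_i γ σ_j⁻¹}` for all `i`, `j`. -/
def matrixComp (𝓡 : GroupoidGrading C R) (σ : I → Arr C) (γ : Arr C) :
    AddSubgroup (FinMatrix I R) where
  carrier := {A | ∀ i j,
    (A : Matrix I I R) i j ∈ compAt 𝓡.comp (pmul₃ (σ i) γ (invArr (σ j)))}
  zero_mem' := fun _ _ => zero_mem _
  add_mem' := fun hA hB i j => add_mem (hA i j) (hB i j)
  neg_mem' := fun hA i j => neg_mem (hA i j)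

open Classical in
/-- The identity element `𝕀_e = ∑_{d(σ_i) = e} 1_{r(σ_i)} E_ii`. -/
noncomputable def matrixOne (𝓡 : GroupoidGrading C R) (σ : I → Arr C) (hσ : DFinite σ) (e : C) :
    FinMatrix I R :=
  ⟨fun i j => if i = j ∧ (σ i).d = e then 𝓡.one (σ i).r else 0, by
    refine ((hσ e).image fun i => (i, i)).subset ?_
    rintro ⟨i, j⟩ h
    simp only [Set.mem_ofPred_eq, ne_eq, ite_eq_right_iff, Classical.not_imp] at h
    obtain ⟨⟨rfl, h⟩, -⟩ := h
    exact ⟨i, h, rfl⟩⟩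

theorem mem_compAt_none {𝓡 : GroupoidGrading C R} {a : R} (h : a ∈ compAt 𝓡.comp none) : a = 0 := h

theorem compAt_mul {𝓡 : GroupoidGrading C R} {σ ρ τ γ δ : Arr C} {a b : R}
    (ha : a ∈ compAt 𝓡.comp (pmul₃ σ γ (invArr ρ)))
    (hb : b ∈ compAt 𝓡.comp (pmul₃ ρ δ (invArr τ))) :
    (pmul γ δ = none → a * b = 0) ∧
      ∀ ε, pmul γ δ = some ε → a * b ∈ compAt 𝓡.comp (pmul₃ σ ε (invArr τ)) := by
  by_cases h1 : γ.r = σ.d ∧ (invArr ρ).r = γ.d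
  swap
  · rw [pmul₃_eq_none h1] at ha
    rw [mem_compAt_none ha, zero_mul]
    exact ⟨fun _ => rfl, fun _ _ => zero_mem _⟩
  by_cases h2 : δ.r = ρ.d ∧ (invArr τ).r = δ.d
  swap
  · rw [pmul₃_eq_none h2] at hb
    rw [mem_compAt_none hb, mul_zero]
    exact ⟨fun _ => rfl, fun _ _ => zero_mem _⟩
  obtain ⟨x, y, g⟩ := γ
  obtain ⟨x', y', g'⟩ := δ
  obtain ⟨p, q, s⟩ := σ
  obtain ⟨c, d, t⟩ := τ
  obtain ⟨k, l, u⟩ := ρ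
  obtain ⟨h1, h1'⟩ := h1
  obtain ⟨h2, h2'⟩ := h2
  simp only [invArr] at h1 h1' h2 h2' ha hb ⊢
  subst h1; subst h1'; subst h2; subst h2'
  rw [pmul₃_mk] at ha hb
  have hab := 𝓡.mul_mem (show a ∈ 𝓡.comp _ from ha) (show b ∈ 𝓡.comp _ from hb)
  rw [pmul_mk] at hab
  rw [pmul_mk]
  refine ⟨fun h => (Option.some_ne_none _ h).elim, fun ε h => ?_⟩
  obtain rfl := Option.some.inj h
  rw [pmul₃_mk]
  simpa using hab

theorem mem_compAt_mul {𝓡 : GroupoidGrading C R} {σ γ τ : Arr C} {a : R}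
    (ha : a ∈ compAt 𝓡.comp (pmul₃ σ γ (invArr τ))) :
    (σ.d ≠ γ.r → a = 0) ∧ (τ.d ≠ γ.d → a = 0) ∧ 𝓡.one σ.r * a = a ∧ a * 𝓡.one τ.r = a := by
  by_cases h1 : γ.r = σ.d ∧ (invArr τ).r = γ.d
  swap
  · rw [pmul₃_eq_none h1] at ha
    rw [mem_compAt_none ha]
    simp
  refine ⟨fun h => absurd h1.1.symm h, fun h => absurd h1.2 h, ?_⟩
  obtain ⟨x, y, g⟩ := γ
  obtain ⟨p, q, s⟩ := σ
  obtain ⟨c, d, t⟩ := τ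
  obtain ⟨h1, h1'⟩ := h1
  simp only [invArr] at h1 h1' ha
  subst h1; subst h1'
  rw [pmul₃_mk] at ha
  exact ⟨𝓡.one_mul (γ := ⟨d, q, Groupoid.inv t ≫ g ≫ s⟩) ha,
    𝓡.mul_one (γ := ⟨d, q, Groupoid.inv t ≫ g ≫ s⟩) ha⟩

/-- The components `M_I(R)(σ)_γ` inside the ring of matrices with finitely many nonzero entries. -/
noncomputable def matrixPreGrading (𝓡 : GroupoidGrading C R) (σ : I → Arr C) (hσ : DFinite σ) :
    PreGrading C (FinMatrix I R) where
  comp := matrixComp 𝓡 σ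
  indep := by
    intro γ
    rw [AddSubgroup.disjoint_def]
    intro A hA hA'
    apply finMatrix_ext
    intro i j
    have hij := hA i j
    rw [finMatrix_zero_apply]
    cases hp : pmul₃ (σ i) γ (invArr (σ j)) with
    | none =>
      rw [hp] at hij
      exact hij
    | some ρ =>
      rw [hp] at hij
      have h := 𝓡.indep ρ
      rw [AddSubgroup.disjoint_def] at h
      let ev : FinMatrix I R →+ R :=
        { toFun := fun B => (B : Matrix I I R) i j
          map_zero' := rfl
          map_add' := fun _ _ => rfl }
      have key : (⨆ δ, ⨆ (_ : δ ≠ γ), matrixComp 𝓡 σ δ) ≤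
          (⨆ δ, ⨆ (_ : δ ≠ ρ), 𝓡.comp δ).comap ev := by
        refine iSup_le fun δ => iSup_le fun hδ => ?_
        intro B hB
        have hB' := hB i j
        change (B : Matrix I I R) i j ∈ (⨆ δ, ⨆ (_ : δ ≠ ρ), 𝓡.comp δ)
        cases hq : pmul₃ (σ i) δ (invArr (σ j)) with
        | none =>
          rw [hq] at hB'
          rw [mem_compAt_none hB']
          exact zero_mem _
        | some ρ' =>
          rw [hq] at hB'
          have hne : ρ' ≠ ρ := by
            rintro rfl
            exact hδ (pmul₃_inj hq hp)
          exact (le_iSup₂ (f := fun δ (_ : δ ≠ ρ) => 𝓡.comp δ) ρ' hne) hB'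
      exact h hij (key hA')
  mul_mem := by
    intro γ δ A B hA hB
    obtain ⟨s, hs⟩ := finMatrix_exists_finset A
    cases hp : pmul γ δ with
    | none =>
      change A * B = 0
      apply finMatrix_ext
      intro i j
      rw [finMatrix_mul_eq A B s hs, finMatrix_zero_apply]
      exact Finset.sum_eq_zero fun k _ => (compAt_mul (hA i k) (hB k j)).1 hp
    | some ε =>
      change A * B ∈ matrixComp 𝓡 σ ε
      intro i j
      rw [finMatrix_mul_eq A B s hs]
      exact sum_mem fun k _ => (compAt_mul (hA i k) (hB k j)).2 ε hp
  one := matrixOne 𝓡 σ hσ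
  one_mem := by
    classical
    intro e i j
    change (if i = j ∧ (σ i).d = e then 𝓡.one (σ i).r else 0) ∈ _
    split
    · rename_i h
      obtain ⟨rfl, rfl⟩ := h
      have := 𝓡.one_mem (σ i).r
      have h3 : pmul₃ (σ i) (idArr (σ i).d) (invArr (σ i)) = some (idArr (σ i).r) := by
        obtain ⟨x, y, g⟩ := σ i
        simp [idArr, invArr, pmul₃_mk]
      rw [h3]
      exact this
    · exact zero_mem _
  one_mul := by
    classical
    intro γ A hA
    apply finMatrix_ext
    intro i j
    have h := mem_compAt_mul (hA i j)
    rw [finMatrix_mul_apply, finsum_eq_single _ i]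
    · change (if i = i ∧ (σ i).d = γ.r then 𝓡.one (σ i).r else 0) * _ = _
      by_cases hi : (σ i).d = γ.r
      · simpa [hi] using h.2.2.1
      · rw [h.1 hi, mul_zero]
    · intro k hk
      change (if i = k ∧ (σ i).d = γ.r then 𝓡.one (σ i).r else 0) * _ = _
      simp [hk.symm]
  mul_one := by
    classical
    intro γ A hA
    apply finMatrix_ext
    intro i j
    have h := mem_compAt_mul (hA i j)
    rw [finMatrix_mul_apply, finsum_eq_single _ j]
    · change _ * (if j = j ∧ (σ j).d = γ.d then 𝓡.one (σ j).r else 0) = _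
      by_cases hj : (σ j).d = γ.d
      · simpa [hj] using h.2.2.2
      · rw [h.2.1 hj, zero_mul]
    · intro k hk
      change _ * (if k = j ∧ (σ k).d = γ.d then 𝓡.one (σ k).r else 0) = _
      simp [hk]

/-- The underlying ring of `M_I(R)(σ) = ⊕_γ M_I(R)(σ)_γ`. -/
noncomputable abbrev GrMatrix (𝓡 : GroupoidGrading C R) (σ : I → Arr C) (hσ : DFinite σ) :
    NonUnitalSubring (FinMatrix I R) :=
  (matrixPreGrading 𝓡 σ hσ).subring

/-- The graded matrix ring `M_I(R)(σ)`, for a `d`-finite sequence `σ` in `Γ`. -/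
noncomputable def grMatrix (𝓡 : GroupoidGrading C R) (σ : I → Arr C) (hσ : DFinite σ) :
    GroupoidGrading C (GrMatrix 𝓡 σ hσ) :=
  (matrixPreGrading 𝓡 σ hσ).toGrading

/-- The graded ring `M_1(R)(σ)` of `1 × 1` matrices, for `σ ∈ Γ`. -/
noncomputable abbrev grMatrixOne (𝓡 : GroupoidGrading C R) (σ : Arr C) :
    GroupoidGrading C (GrMatrix 𝓡 (fun _ : Unit => σ) (DFinite.of_finite _)) :=
  grMatrix 𝓡 (fun _ : Unit => σ) (DFinite.of_finite _)

end GradedMatrix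

/-- `δ ∈ τ X σ`, for a subset `X` of `Γ`: there is `α ∈ X` such that `τ α σ` is defined and equals
`δ`. -/
def MemTranslate {C : Type*} [Groupoid C] (τ : Arr C) (X : Set (Arr C)) (σ δ : Arr C) : Prop :=
  ∃ α ∈ X, pmul₃ τ α σ = some δ

end GroupoidGraded

open GroupoidGraded

/-! Groupoid products are written from right to left below, as opposed to `≫`.

Matrix rings, sufficiency. If `δ_{π(i)} = τ ω_i σ_i` with `ω_i ∈ supp D`, choose nonzero `u_i ∈
D_{ω_i}`. With `ψ : D ≃ D'` shifting degrees by conjugation with `τ`, the map `(a_ij) ↦ (ψ(u_i a_ij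
u_j⁻¹))`, reindexed by `π`, is a graded isomorphism (`grIso_grMatrix_of_memTranslate`).

Matrix rings, necessity. Let `Φ` be the isomorphism and fix `i₀`. The idempotent `Φ(E_{i₀i₀})` is
equivalent to some `E_kk` by factors `P`, `Q` whose degree is an object (`exists_idempotent_equiv`).
Hence the corners `D` and `D'` are isomorphic, with degrees conjugated by `τ = δ_k σ_{i₀}⁻¹`. The
entries `X i l = (Q Φ(E_{i₀i}))_{kl}` and `Y l i = (Φ(E_{ii₀}) P)_{lk}` form mutually inverse
matrices over `D'`, and `X i l ≠ 0` forces `τσ_i ∈ (supp D')δ_l`. So `X` is block diagonal along the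
cosets of `supp D'`. By `d`-finiteness the blocks are finite; after rescaling they become invertible
matrices over the division ring `D'_{e'}`, hence are square (`card_inCoset_le`). Matching rows with
columns coset by coset gives `π`.

Products. An isomorphism `φ` of graded products induces graded homomorphisms `R_j → T_k`, each
injective or zero. Since `R_j` is an ideal, exactly one `k` gives a nonzero map for each `j`
(`crossHom_unique`); the same for `φ⁻¹` makes the correspondence bijective and the maps
isomorphisms. The Wedderburn–Artin statement combines both results, as graded matrix rings over
graded division rings are gr-simple (`isGrSimple_fullMatrix`). -/

namespace GroupoidGraded

/-! ### Graded homomorphisms and isomorphisms -/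

namespace GroupoidGrading

variable {C : Type*} [Groupoid C] {R S T : Type*} [NonUnitalRing R] [NonUnitalRing S]
  [NonUnitalRing T]

theorem iSup_comp (𝓡 : GroupoidGrading C R) : ⨆ γ, 𝓡.comp γ = ⊤ := by
  classical
  rw [eq_top_iff]
  rintro a -
  obtain ⟨x, rfl⟩ := 𝓡.isInternal.2 a
  rw [DirectSum.coeAddMonoidHom_eq_dfinsuppSum]
  exact sum_mem fun γ _ => le_iSup 𝓡.comp γ (x γ).2

theorem addHom_induction (𝓡 : GroupoidGrading C R) {p : R → Prop} (a : R)
    (hom : ∀ γ, ∀ x ∈ 𝓡.comp γ, p x) (zero : p 0) (add : ∀ x y, p x → p y → p (x + y)) : p a :=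
  AddSubgroup.iSup_induction 𝓡.comp (C := p) (x := a) (by rw [iSup_comp]; trivial) hom zero add

/-- An element is the sum of homogeneous elements; if it is mapped by a graded additive map into one
component, then its homogeneous component of that degree has the same image. -/
theorem exists_decomposition (𝓡 : GroupoidGrading C R) (𝓢 : GroupoidGrading C S) (h : R →+ S)
    (hh : ∀ γ, ∀ a ∈ 𝓡.comp γ, h a ∈ 𝓢.comp γ) (a : R) :
    ∃ (s : Finset (Arr C)) (x : Arr C → R), (∀ γ, x γ ∈ 𝓡.comp γ) ∧ a = ∑ γ ∈ s, x γ ∧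
      ∀ γ, h a ∈ 𝓢.comp γ → h (x γ) = h a := by
  classical
  obtain ⟨x, rfl⟩ := 𝓡.isInternal.2 a
  refine ⟨x.support, fun γ => x γ, fun γ => (x γ).2, ?_, fun γ hγ => ?_⟩
  · rw [DirectSum.coeAddMonoidHom_eq_dfinsuppSum]
    rfl
  -- Decompositions in `S` are unique: the components of `h a` are the images of the components of
  -- `a`, while `h a` has only a component of degree `γ`.
  have key : DirectSum.map (fun γ => (h.comp (𝓡.comp γ).subtype).codRestrict (𝓢.comp γ)
      fun a => hh γ _ a.2) x = DirectSum.of (fun γ => 𝓢.comp γ) γ ⟨_, hγ⟩ := by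
    apply 𝓢.isInternal.1
    rw [DirectSum.coeAddMonoidHom_of]
    refine DFunLike.congr_fun (f := (DirectSum.coeAddMonoidHom 𝓢.comp).comp (DirectSum.map _))
      (g := h.comp (DirectSum.coeAddMonoidHom 𝓡.comp)) ?_ x
    ext δ y
    simp
  have key' : ∀ δ, h (x δ) = DirectSum.of (fun γ => 𝓢.comp γ) γ ⟨_, hγ⟩ δ := by
    intro δ
    rw [← key]
    simp
  rw [key', DirectSum.of_eq_same]

/-- The inverse of a graded isomorphism is graded. -/
theorem symm_mem_comp {𝓡 : GroupoidGrading C R} {𝓢 : GroupoidGrading C S} (φ : R ≃+* S)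
    (hφ : ∀ γ, ∀ a ∈ 𝓡.comp γ, φ a ∈ 𝓢.comp γ) {γ : Arr C} {b : S} (hb : b ∈ 𝓢.comp γ) :
    φ.symm b ∈ 𝓡.comp γ := by
  obtain ⟨s, x, hx, -, h⟩ := exists_decomposition 𝓡 𝓢 (φ : R →+ S) hφ (φ.symm b)
  have h1 := h γ (by simpa using hb)
  have h2 : x γ = φ.symm b := φ.injective (by simpa using h1)
  rw [← h2]
  exact hx γ

/-- An isomorphism of rings that respects the homogeneous components respects the identity elements
`1_e`. -/
theorem GrIso.of_ringEquiv {𝓡 : GroupoidGrading C R} {𝓢 : GroupoidGrading C S} (φ : R ≃+* S)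
    (hφ : ∀ γ, ∀ a ∈ 𝓡.comp γ, φ a ∈ 𝓢.comp γ) : GrIso 𝓡 𝓢 := by
  refine ⟨φ, hφ, fun e => ?_⟩
  -- Both `φ(1_e)` and `1_e` equal `φ(1_e) 1_e`: the first by the identity law in `S`, the second by
  -- applying `φ` to the identity law for `φ⁻¹(1_e)`.
  have h1 := 𝓡.one_mul (γ := idArr e) (symm_mem_comp φ hφ (𝓢.one_mem e))
  have h2 := 𝓢.mul_one (γ := idArr e) (hφ _ _ (𝓡.one_mem e))
  have h3 := congrArg φ h1
  rw [map_mul, RingEquiv.apply_symm_apply] at h3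
  exact h2.symm.trans h3

theorem GrIso.symm {𝓡 : GroupoidGrading C R} {𝓢 : GroupoidGrading C S} (h : GrIso 𝓡 𝓢) :
    GrIso 𝓢 𝓡 := by
  obtain ⟨φ, hφ, -⟩ := h
  exact GrIso.of_ringEquiv φ.symm fun γ b hb => symm_mem_comp φ hφ hb

theorem GrIso.trans {𝓡 : GroupoidGrading C R} {𝓢 : GroupoidGrading C S} {𝓣 : GroupoidGrading C T}
    (h : GrIso 𝓡 𝓢) (h' : GrIso 𝓢 𝓣) : GrIso 𝓡 𝓣 := by
  obtain ⟨φ, hφ, -⟩ := h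
  obtain ⟨ψ, hψ, -⟩ := h'
  exact GrIso.of_ringEquiv (φ.trans ψ) fun γ a ha => hψ γ _ (hφ γ a ha)

/-- The kernel of a graded homomorphism is a graded ideal. -/
theorem isGradedIdeal_ker (𝓡 : GroupoidGrading C R) (𝓢 : GroupoidGrading C S) (h : R →ₙ+* S)
    (hh : ∀ γ, ∀ a ∈ 𝓡.comp γ, h a ∈ 𝓢.comp γ) : 𝓡.IsGradedIdeal (h : R →+ S).ker := by
  refine ⟨fun r x hx => ?_, le_antisymm (fun a ha => ?_) (iSup_le fun γ => inf_le_left)⟩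
  · have hx' : h x = 0 := hx
    exact ⟨show h (r * x) = 0 by rw [map_mul, hx', mul_zero],
      show h (x * r) = 0 by rw [map_mul, hx', zero_mul]⟩
  · have ha' : (h : R →+ S) a = 0 := ha
    obtain ⟨s, x, hx, hs, H⟩ := exists_decomposition 𝓡 𝓢 (h : R →+ S) hh a
    rw [hs]
    refine sum_mem fun γ _ => ?_
    have := H γ (by rw [ha']; exact zero_mem _)
    refine (le_iSup (fun γ => (h : R →+ S).ker ⊓ 𝓡.comp γ) γ) ⟨?_, hx γ⟩
    exact this.trans ha'

/-- The graded form of Schur's dichotomy: the kernel is a graded ideal of a gr-simple ring. -/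
theorem IsGrSimple.injective_or_eq_zero {𝓡 : GroupoidGrading C R} (hR : 𝓡.IsGrSimple)
    (𝓢 : GroupoidGrading C S) (h : R →ₙ+* S) (hh : ∀ γ, ∀ a ∈ 𝓡.comp γ, h a ∈ 𝓢.comp γ) :
    (∀ a, h a = 0 → a = 0) ∨ ∀ a, h a = 0 := by
  rcases hR.2 _ (isGradedIdeal_ker 𝓡 𝓢 h hh) with h' | h'
  · exact Or.inl fun a ha => (AddSubgroup.eq_bot_iff_forall _).1 h' a ha
  · refine Or.inr fun a => ?_
    have : a ∈ (h : R →+ S).ker := by rw [h']; trivial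
    exact this

end GroupoidGrading

/-! ### Transfer of gradings along ring isomorphisms -/

namespace PreGrading

variable {C : Type*} [Groupoid C] {S T : Type*} [NonUnitalRing S] [NonUnitalRing T]

/-- A ring isomorphism that identifies the homogeneous components of two pregradings restricts to a
graded isomorphism. -/
theorem grIso_of_ringEquiv {𝓢 : PreGrading C S} {𝓣 : PreGrading C T} (φ : S ≃+* T)
    (hφ : ∀ γ a, φ a ∈ 𝓣.comp γ ↔ a ∈ 𝓢.comp γ) : 𝓢.toGrading.GrIso 𝓣.toGrading := by
  have h1 : ∀ a ∈ 𝓢.subring, φ a ∈ 𝓣.subring := by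
    intro a ha
    refine AddSubgroup.iSup_induction 𝓢.comp (C := fun a => φ a ∈ 𝓣.subring) ha ?_ ?_ ?_
    · exact fun γ x hx => 𝓣.comp_le ((hφ γ x).2 hx)
    · rw [map_zero]
      exact zero_mem _
    · intro x y hx hy
      rw [map_add]
      exact add_mem hx hy
  have h2 : ∀ b ∈ 𝓣.subring, φ.symm b ∈ 𝓢.subring := by
    intro b hb
    refine AddSubgroup.iSup_induction 𝓣.comp (C := fun b => φ.symm b ∈ 𝓢.subring) hb ?_ ?_ ?_
    · exact fun γ x hx => 𝓢.comp_le ((hφ γ _).1 (by simpa using hx))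
    · rw [map_zero]
      exact zero_mem _
    · intro x y hx hy
      rw [map_add]
      exact add_mem hx hy
  exact GroupoidGrading.GrIso.of_ringEquiv
    { toFun := fun a => ⟨φ a, h1 a a.2⟩
      invFun := fun b => ⟨φ.symm b, h2 b b.2⟩
      left_inv := fun a => Subtype.ext (φ.symm_apply_apply _)
      right_inv := fun b => Subtype.ext (φ.apply_symm_apply _)
      map_mul' := fun a b => Subtype.ext (map_mul φ _ _)
      map_add' := fun a b => Subtype.ext (map_add φ _ _) } fun γ a ha => (hφ γ a).2 ha

open Classical in
/-- A pregrading that spans the ring is a grading. -/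
def ofTop (𝓢 : PreGrading C S) (h : 𝓢.subring = ⊤) : GroupoidGrading C S where
  comp := 𝓢.comp
  isInternal := by
    constructor
    · exact 𝓢.indep.dfinsuppSumAddHom_injective
    · intro x
      have hx : x ∈ 𝓢.subring := by rw [h]; trivial
      refine AddSubgroup.iSup_induction 𝓢.comp
        (C := fun x => ∃ a, (DirectSum.coeAddMonoidHom 𝓢.comp) a = x) hx ?_ ?_ ?_
      · intro γ y hy
        exact ⟨DirectSum.of (fun γ => 𝓢.comp γ) γ ⟨y, hy⟩, by simp⟩
      · exact ⟨0, map_zero _⟩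
      · rintro y z ⟨a, rfl⟩ ⟨b, rfl⟩
        exact ⟨a + b, map_add _ _ _⟩
  mul_mem := 𝓢.mul_mem
  one := 𝓢.one
  one_mem := 𝓢.one_mem
  one_mul := 𝓢.one_mul
  mul_one := 𝓢.mul_one

theorem grIso_ofTop (𝓢 : PreGrading C S) (h : 𝓢.subring = ⊤) :
    𝓢.toGrading.GrIso (𝓢.ofTop h) :=
  GroupoidGrading.GrIso.of_ringEquiv
    { toFun := fun a => a
      invFun := fun a => ⟨a, by rw [h]; trivial⟩
      left_inv := fun _ => rfl
      right_inv := fun _ => rfl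
      map_mul' := fun _ _ => rfl
      map_add' := fun _ _ => rfl } fun _ _ ha => ha

end PreGrading

/-! ### Graded products of gr-simple rings -/

section Product

variable {C : Type*} [Groupoid C] {J J' : Type*} {R : J → Type*} {T : J' → Type*}
  [∀ j, NonUnitalRing (R j)] [∀ j, NonUnitalRing (T j)]

theorem grProd_grIso_of_equiv (𝓡 : ∀ j, GroupoidGrading C (R j)) (𝓣 : ∀ j, GroupoidGrading C (T j))
    (π : J ≃ J') (h : ∀ j, (𝓡 j).GrIso (𝓣 (π j))) : (grProd 𝓡).GrIso (grProd 𝓣) := by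
  choose φ hφ _ using h
  refine PreGrading.grIso_of_ringEquiv
    ((RingEquiv.piCongrRight φ).trans (RingEquiv.piCongrLeft T π)) fun γ a => ?_
  have key : ∀ j, ((RingEquiv.piCongrRight φ).trans (RingEquiv.piCongrLeft T π)) a (π j)
      = φ j (a j) := by
    intro j
    exact Equiv.piCongrLeft_apply_apply T π (fun j => φ j (a j)) j
  constructor
  · intro ha j _
    have := ha (π j) trivial
    rw [key] at this
    simpa using GroupoidGrading.symm_mem_comp (φ j) (hφ j) this
  · intro ha k _
    obtain ⟨j, rfl⟩ := π.surjective k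
    rw [key]
    exact hφ j γ _ (ha j trivial)

open Classical in
/-- The embedding of a factor into the graded product. -/
noncomputable def grSingle (𝓡 : ∀ j, GroupoidGrading C (R j)) (j : J) : R j →ₙ+* GrProd 𝓡 where
  toFun a := ⟨Pi.single j a, by
    refine (𝓡 j).addHom_induction (p := fun a => Pi.single j a ∈ GrProd 𝓡) a ?_ ?_ ?_
    · intro γ x hx
      refine (prodPreGrading 𝓡).comp_le (γ := γ) fun i _ => ?_
      by_cases hi : i = j
      · subst hi
        simpa using hx
      · rw [Pi.single_eq_of_ne hi]
        exact zero_mem ((𝓡 i).comp γ)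
    · rw [Pi.single_zero]
      exact zero_mem _
    · intro x y hx hy
      rw [Pi.single_add]
      exact add_mem hx hy⟩
  map_zero' := Subtype.ext (Pi.single_zero j)
  map_add' a b := Subtype.ext (Pi.single_add j a b)
  map_mul' a b := Subtype.ext (Pi.single_mul j a b)

variable (𝓡 : ∀ j, GroupoidGrading C (R j)) (𝓣 : ∀ j, GroupoidGrading C (T j))

@[simp] theorem grSingle_same (j : J) (a : R j) : (grSingle 𝓡 j a : ∀ j, R j) j = a := by
  classical
  exact Pi.single_eq_same (M := R) j a

theorem grSingle_of_ne {i j : J} (h : i ≠ j) (a : R j) : (grSingle 𝓡 j a : ∀ j, R j) i = 0 := by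
  classical
  exact Pi.single_eq_of_ne (M := R) h a

theorem grSingle_mem (j : J) {γ : Arr C} {a : R j} (ha : a ∈ (𝓡 j).comp γ) :
    grSingle 𝓡 j a ∈ (grProd 𝓡).comp γ := by
  intro i _
  by_cases hi : i = j
  · subst hi
    change (grSingle 𝓡 i a : ∀ j, R j) i ∈ _
    rwa [grSingle_same]
  · change (grSingle 𝓡 j a : ∀ j, R j) i ∈ _
    rw [grSingle_of_ne 𝓡 hi]
    exact zero_mem ((𝓡 i).comp γ)

/-- Each factor is a left ideal of the product; this is what allows `φ(R_j)` to be multiplied by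
elements of a single `T_k` without leaving it. -/
theorem mul_grSingle (f : GrProd 𝓡) (j : J) (a : R j) :
    f * grSingle 𝓡 j a = grSingle 𝓡 j ((f : ∀ j, R j) j * a) := by
  refine Subtype.ext (funext fun i => ?_)
  change (f : ∀ j, R j) i * (grSingle 𝓡 j a : ∀ j, R j) i = _
  by_cases hi : i = j
  · subst hi
    rw [grSingle_same, grSingle_same]
  · rw [grSingle_of_ne 𝓡 hi, grSingle_of_ne 𝓡 hi, mul_zero]

/-- The homomorphism `R_j → ∏ R_j → ∏ T_k → T_k` given by a homomorphism of graded products. -/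
noncomputable def crossHom (φ : GrProd 𝓡 ≃+* GrProd 𝓣) (j : J) (k : J') : R j →ₙ+* T k where
  toFun a := (φ (grSingle 𝓡 j a) : ∀ k, T k) k
  map_zero' := by simp
  map_add' a b := by simp
  map_mul' a b := by simp

variable {𝓡 𝓣}

theorem crossHom_apply (φ : GrProd 𝓡 ≃+* GrProd 𝓣) (j : J) (k : J') (a : R j) :
    crossHom 𝓡 𝓣 φ j k a = (φ (grSingle 𝓡 j a) : ∀ k, T k) k := rfl

theorem crossHom_mem {φ : GrProd 𝓡 ≃+* GrProd 𝓣}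
    (hφ : ∀ γ, ∀ a ∈ (grProd 𝓡).comp γ, φ a ∈ (grProd 𝓣).comp γ) (j : J) (k : J') (γ : Arr C)
    (a : R j) (ha : a ∈ (𝓡 j).comp γ) : crossHom 𝓡 𝓣 φ j k a ∈ (𝓣 k).comp γ :=
  hφ γ _ (grSingle_mem 𝓡 j ha) k trivial

/-- Were the map into another `T_{k'}` nonzero, it would be injective by gr-simplicity. Cutting
`φ(x)` down to its coordinate `k` stays in the ideal `φ(R_j)` and kills the coordinate `k'`, so the
cut element is `0`, and the map into `T_k` vanishes on every homogeneous `x`. -/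
theorem crossHom_unique {φ : GrProd 𝓡 ≃+* GrProd 𝓣}
    (hφ : ∀ γ, ∀ a ∈ (grProd 𝓡).comp γ, φ a ∈ (grProd 𝓣).comp γ) {j : J}
    (hj : (𝓡 j).IsGrSimple) {k : J'} {a : R j} (ha : crossHom 𝓡 𝓣 φ j k a ≠ 0) {k' : J'}
    (hk : k' ≠ k) (b : R j) : crossHom 𝓡 𝓣 φ j k' b = 0 := by
  refine (hj.injective_or_eq_zero (𝓣 k') _ (crossHom_mem hφ j k')).resolve_left (fun hinj => ?_) b
  apply ha
  refine (𝓡 j).addHom_induction (p := fun a => crossHom 𝓡 𝓣 φ j k a = 0) a (fun γ x hx => ?_)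
    (map_zero _) fun x y hx hy => by rw [map_add, hx, hy, add_zero]
  -- The identity `1_{r(γ)}` of the factor `T_k` isolates the coordinate `k` of `φ(x)`; `c ∈ R_j` is
  -- the preimage of the result.
  set u := grSingle 𝓣 k ((𝓣 k).one γ.r) with hu
  set c := (φ.symm u : ∀ j, R j) j * x with hc
  have h1 : φ (grSingle 𝓡 j c) = u * φ (grSingle 𝓡 j x) := by
    rw [hc, ← mul_grSingle, map_mul, RingEquiv.apply_symm_apply]
  have h2 : ∀ l, crossHom 𝓡 𝓣 φ j l c = (u : ∀ k, T k) l * crossHom 𝓡 𝓣 φ j l x := fun l => by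
    rw [crossHom_apply, h1]
    rfl
  have h3 : c = 0 := hinj c (by rw [h2, hu, grSingle_of_ne 𝓣 hk, zero_mul])
  have h4 := h2 k
  rw [hu, grSingle_same, (𝓣 k).one_mul (crossHom_mem hφ j k γ x hx), h3, map_zero] at h4
  exact h4.symm

theorem apply_grSingle_eq {φ : GrProd 𝓡 ≃+* GrProd 𝓣}
    (hφ : ∀ γ, ∀ a ∈ (grProd 𝓡).comp γ, φ a ∈ (grProd 𝓣).comp γ) {j : J}
    (hj : (𝓡 j).IsGrSimple) {k : J'} {a : R j} (ha : crossHom 𝓡 𝓣 φ j k a ≠ 0) (b : R j) :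
    φ (grSingle 𝓡 j b) = grSingle 𝓣 k (crossHom 𝓡 𝓣 φ j k b) := by
  refine Subtype.ext (funext fun l => ?_)
  by_cases hl : l = k
  · subst hl
    rw [grSingle_same]
    rfl
  · rw [grSingle_of_ne 𝓣 hl]
    exact crossHom_unique hφ hj ha hl b

theorem exists_crossHom_ne_zero (φ : GrProd 𝓡 ≃+* GrProd 𝓣) {j : J}
    (hj : (𝓡 j).IsGrSimple) : ∃ k a, crossHom 𝓡 𝓣 φ j k a ≠ 0 := by
  obtain ⟨⟨a, ha⟩, -⟩ := hj
  by_contra! h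
  apply ha
  have h1 : φ (grSingle 𝓡 j a) = 0 := Subtype.ext (funext fun k => h k a)
  have h2 : grSingle 𝓡 j a = 0 := by simpa using h1
  rw [← grSingle_same 𝓡 j a, h2]
  rfl

/-- No information is lost in passing to the coordinate `k`, because the image of `R_j` under `φ`
lies entirely in `T_k`. -/
theorem crossHom_symm_apply {φ : GrProd 𝓡 ≃+* GrProd 𝓣}
    (hφ : ∀ γ, ∀ a ∈ (grProd 𝓡).comp γ, φ a ∈ (grProd 𝓣).comp γ) {j : J}
    (hj : (𝓡 j).IsGrSimple) {k : J'} {a : R j} (ha : crossHom 𝓡 𝓣 φ j k a ≠ 0) (b : R j) :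
    crossHom 𝓣 𝓡 φ.symm k j (crossHom 𝓡 𝓣 φ j k b) = b := by
  rw [crossHom_apply, ← apply_grSingle_eq hφ hj ha, RingEquiv.symm_apply_apply, grSingle_same]

/-- An isomorphism of graded products of gr-simple rings matches the factors. -/
theorem exists_equiv_of_grProd_grIso (h𝓡 : ∀ j, (𝓡 j).IsGrSimple) (h𝓣 : ∀ j, (𝓣 j).IsGrSimple)
    (h : (grProd 𝓡).GrIso (grProd 𝓣)) : ∃ π : J ≃ J', ∀ j, (𝓡 j).GrIso (𝓣 (π j)) := by
  obtain ⟨φ, hφ, -⟩ := h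
  have hφ' : ∀ γ, ∀ b ∈ (grProd 𝓣).comp γ, φ.symm b ∈ (grProd 𝓡).comp γ :=
    fun γ b hb => GroupoidGrading.symm_mem_comp φ hφ hb
  choose f hf using fun j => exists_crossHom_ne_zero φ (h𝓡 j)
  choose g hg using fun k => exists_crossHom_ne_zero φ.symm (h𝓣 k)
  have h1 : ∀ j, ∃ b, crossHom 𝓣 𝓡 φ.symm (f j) j b ≠ 0 := by
    intro j
    obtain ⟨a, ha⟩ := hf j
    refine ⟨crossHom 𝓡 𝓣 φ j (f j) a, ?_⟩
    rw [crossHom_symm_apply hφ (h𝓡 j) ha]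
    rintro rfl
    exact ha (map_zero _)
  have h2 : ∀ k, ∃ a, crossHom 𝓡 𝓣 φ (g k) k a ≠ 0 := by
    intro k
    obtain ⟨b, hb⟩ := hg k
    refine ⟨crossHom 𝓣 𝓡 φ.symm k (g k) b, ?_⟩
    have := crossHom_symm_apply hφ' (h𝓣 k) hb b
    rw [RingEquiv.symm_symm] at this
    rw [this]
    rintro rfl
    exact hb (map_zero _)
  -- The maps from `T_{f j}` induced by `φ⁻¹` are nonzero both into `R_j` and, by the choice of `g`,
  -- into `R_{g (f j)}`; uniqueness identifies the two indices.
  have hgf : ∀ j, g (f j) = j := by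
    intro j
    obtain ⟨b, hb⟩ := h1 j
    obtain ⟨c, hc⟩ := hg (f j)
    by_contra hne
    exact hc (crossHom_unique hφ' (h𝓣 _) hb hne c)
  have hfg : ∀ k, f (g k) = k := by
    intro k
    obtain ⟨b, hb⟩ := h2 k
    obtain ⟨c, hc⟩ := hf (g k)
    by_contra hne
    exact hc (crossHom_unique hφ (h𝓡 _) hb hne c)
  refine ⟨⟨f, g, hgf, hfg⟩, fun j => ?_⟩
  obtain ⟨a, ha⟩ := hf j
  obtain ⟨b, hb⟩ := h1 j
  refine GroupoidGrading.GrIso.of_ringEquiv (S := T (f j))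
    { crossHom 𝓡 𝓣 φ j (f j) with
      invFun := crossHom 𝓣 𝓡 φ.symm (f j) j
      left_inv := crossHom_symm_apply hφ (h𝓡 j) ha
      right_inv := fun c => ?_ } (crossHom_mem hφ j (f j))
  have := crossHom_symm_apply hφ' (h𝓣 (f j)) hb c
  rwa [RingEquiv.symm_symm] at this

end Product

end GroupoidGraded

/-! ### Graded division rings and their components at objects -/

namespace GroupoidGraded

namespace GroupoidGrading

variable {C : Type*} [Groupoid C] {D : Type*} [NonUnitalRing D] {𝓓 : GroupoidGrading C D} {e : C}

/-- All components outside `e Γ e` vanish, so the local identity at `e` serves every element. -/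
theorem SupportedAt.one_mul (h : 𝓓.SupportedAt e) (a : D) : 𝓓.one e * a = a := by
  refine 𝓓.addHom_induction (p := fun a => 𝓓.one e * a = a) a (fun γ x hx => ?_) (mul_zero _)
    fun x y hx hy => by rw [mul_add, hx, hy]
  by_cases hγ : 𝓓.comp γ = ⊥
  · rw [hγ] at hx
    rw [(AddSubgroup.mem_bot).1 hx, mul_zero]
  · rw [← (h γ hγ).1]
    exact 𝓓.one_mul hx

theorem SupportedAt.mul_one (h : 𝓓.SupportedAt e) (a : D) : a * 𝓓.one e = a := by
  refine 𝓓.addHom_induction (p := fun a => a * 𝓓.one e = a) a (fun γ x hx => ?_) (zero_mul _)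
    fun x y hx hy => by rw [add_mul, hx, hy]
  by_cases hγ : 𝓓.comp γ = ⊥
  · rw [hγ] at hx
    rw [(AddSubgroup.mem_bot).1 hx, zero_mul]
  · rw [← (h γ hγ).2]
    exact 𝓓.mul_one hx

theorem SupportedAt.induction (h : 𝓓.SupportedAt e) {p : D → Prop} (a : D)
    (hom : ∀ α : e ⟶ e, ∀ x ∈ 𝓓.comp ⟨e, e, α⟩, p x) (zero : p 0)
    (add : ∀ x y, p x → p y → p (x + y)) : p a := by
  refine 𝓓.addHom_induction a (fun γ x hx => ?_) zero add
  by_cases hγ : 𝓓.comp γ = ⊥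
  · rw [hγ] at hx
    rwa [(AddSubgroup.mem_bot).1 hx]
  · obtain ⟨y, z, g⟩ := γ
    obtain ⟨h1, h2⟩ := h _ hγ
    dsimp only at h1 h2
    subst h1 h2
    exact hom g x hx

theorem mul_mem_hom {x y z : C} {f : x ⟶ y} {g : y ⟶ z} {a b : D} (ha : a ∈ 𝓓.comp ⟨y, z, g⟩)
    (hb : b ∈ 𝓓.comp ⟨x, y, f⟩) : a * b ∈ 𝓓.comp ⟨x, z, f ≫ g⟩ := by
  have := 𝓓.mul_mem ha hb
  rwa [pmul_mk] at this

theorem IsGrDivision.one_ne_zero (hD : 𝓓.IsGrDivision) (h : 𝓓.SupportedAt e) : 𝓓.one e ≠ 0 := by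
  obtain ⟨⟨a, ha⟩, -⟩ := hD
  intro h0
  apply ha
  rw [← h.one_mul a, h0, zero_mul]

theorem IsGrDivision.exists_inv (hD : 𝓓.IsGrDivision) {α : e ⟶ e} {a : D}
    (ha : a ∈ 𝓓.comp ⟨e, e, α⟩) (h0 : a ≠ 0) :
    ∃ b ∈ 𝓓.comp ⟨e, e, Groupoid.inv α⟩, a * b = 𝓓.one e ∧ b * a = 𝓓.one e :=
  hD.2 _ a ha h0

theorem IsGrDivision.exists_inv_id (hD : 𝓓.IsGrDivision) {a : D}
    (ha : a ∈ 𝓓.comp (idArr e)) (h0 : a ≠ 0) :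
    ∃ b ∈ 𝓓.comp (idArr e), a * b = 𝓓.one e ∧ b * a = 𝓓.one e := by
  have := hD.2 _ a ha h0
  rwa [show invArr (idArr e) = idArr e by simp [invArr, idArr]] at this

theorem IsGrDivision.mul_ne_zero (hD : 𝓓.IsGrDivision) (h : 𝓓.SupportedAt e) {α : e ⟶ e} {a b : D}
    (ha : a ∈ 𝓓.comp ⟨e, e, α⟩) (ha0 : a ≠ 0) (hb0 : b ≠ 0) : a * b ≠ 0 := by
  obtain ⟨c, -, -, hc⟩ := hD.exists_inv ha ha0
  intro h0
  apply hb0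
  rw [← h.one_mul b, ← hc, mul_assoc, h0, mul_zero]

/-- The ring `D_e`, for `e ∈ Γ₀`. -/
abbrev idCompRing (𝓓 : GroupoidGrading C D) (e : C) : Ring (𝓓.comp (idArr e)) :=
  { (inferInstance : AddCommGroup (𝓓.comp (idArr e))) with
    mul := fun a b => ⟨a * b, by
      have := 𝓓.mul_mem_hom (f := 𝟙 e) (g := 𝟙 e) a.2 b.2
      rwa [Category.id_comp] at this⟩
    one := ⟨𝓓.one e, 𝓓.one_mem e⟩
    left_distrib := fun a b c => Subtype.ext (mul_add (a : D) b c)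
    right_distrib := fun a b c => Subtype.ext (add_mul (a : D) b c)
    zero_mul := fun a => Subtype.ext (zero_mul (a : D))
    mul_zero := fun a => Subtype.ext (mul_zero (a : D))
    mul_assoc := fun a b c => Subtype.ext (mul_assoc (a : D) b c)
    one_mul := fun a => Subtype.ext (𝓓.one_mul (γ := idArr e) a.2)
    mul_one := fun a => Subtype.ext (𝓓.mul_one (γ := idArr e) a.2) }

/-- If `D` is a graded division ring, then `D_e` is a division ring. -/
noncomputable abbrev idCompDivisionRing (hD : 𝓓.IsGrDivision) (h : 𝓓.SupportedAt e) :
    DivisionRing (𝓓.comp (idArr e)) :=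
  letI := idCompRing 𝓓 e
  haveI : Nontrivial (𝓓.comp (idArr e)) :=
    ⟨⟨1, 0, fun h0 => hD.one_ne_zero h (congrArg Subtype.val h0)⟩⟩
  DivisionRing.ofIsUnitOrEqZero fun a => by
    by_cases ha : a = 0
    · exact Or.inr ha
    · obtain ⟨b, hb, h1, h2⟩ := hD.exists_inv_id a.2 fun h0 => ha (Subtype.ext h0)
      exact Or.inl ⟨⟨a, ⟨b, hb⟩, Subtype.ext h1, Subtype.ext h2⟩, rfl⟩

/-- Over `D_e`, a matrix with a right inverse has at most as many rows as columns. -/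
theorem IsGrDivision.card_le_of_mul_eq_one (hD : 𝓓.IsGrDivision) (h : 𝓓.SupportedAt e)
    {A B : Type*} [Fintype A] [Fintype B] [DecidableEq A] (X : A → B → D) (Y : B → A → D)
    (hX : ∀ i l, X i l ∈ 𝓓.comp (idArr e)) (hY : ∀ l i, Y l i ∈ 𝓓.comp (idArr e))
    (hXY : ∀ i i', ∑ l, X i l * Y l i' = if i = i' then 𝓓.one e else 0) :
    Fintype.card A ≤ Fintype.card B := by
  let := idCompDivisionRing hD h
  let X' : Matrix A B (𝓓.comp (idArr e)) := fun i l => ⟨X i l, hX i l⟩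
  let Y' : Matrix B A (𝓓.comp (idArr e)) := fun l i => ⟨Y l i, hY l i⟩
  have hXY' : X' * Y' = 1 := by
    ext i i'
    rw [Matrix.mul_apply, AddSubmonoidClass.coe_finsetSum]
    refine (hXY i i').trans ?_
    rw [Matrix.one_apply]
    split <;> rfl
  -- On row vectors, `v ↦ vX` is injective with left inverse `w ↦ wY`; over a division ring this
  -- bounds the dimensions.
  refine card_le_of_injective (𝓓.comp (idArr e)) X'.vecMulLinear
    (Function.LeftInverse.injective (g := Y'.vecMulLinear) fun v => ?_)
  simp only [Matrix.vecMulLinear_apply]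
  rw [Matrix.vecMul_vecMul, hXY', Matrix.vecMul_one]

end GroupoidGrading

/-! ### Matrices with a single entry -/

section FinSingle

variable {I R : Type*} [NonUnitalRing R]

open Classical in
/-- The matrix with at most one nonzero entry, which is `a` at `(i, j)`. -/
noncomputable def finSingle (i j : I) (a : R) : FinMatrix I R :=
  ⟨fun k l => if k = i ∧ l = j then a else 0, by
    refine (Set.finite_singleton (i, j)).subset fun p hp => ?_
    have hp' : (if p.1 = i ∧ p.2 = j then a else 0) ≠ 0 := hp
    have : p.1 = i ∧ p.2 = j := by
      by_contra h
      exact hp' (if_neg h)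
    exact Prod.ext this.1 this.2⟩

open Classical in
theorem finSingle_apply (i j : I) (a : R) (k l : I) :
    (finSingle i j a : Matrix I I R) k l = if k = i ∧ l = j then a else 0 := rfl

@[simp] theorem finSingle_same (i j : I) (a : R) : (finSingle i j a : Matrix I I R) i j = a := by
  simp [finSingle_apply]

open Classical in
theorem finSingle_mul_apply (i j : I) (a : R) (A : FinMatrix I R) (k l : I) :
    ((finSingle i j a * A : FinMatrix I R) : Matrix I I R) k l
      = if k = i then a * (A : Matrix I I R) j l else 0 := by
  rw [finMatrix_mul_apply, finsum_eq_single _ j]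
  · simp [finSingle_apply]
  · intro m hm
    simp [finSingle_apply, hm]

open Classical in
theorem mul_finSingle_apply (i j : I) (a : R) (A : FinMatrix I R) (k l : I) :
    ((A * finSingle i j a : FinMatrix I R) : Matrix I I R) k l
      = if l = j then (A : Matrix I I R) k i * a else 0 := by
  rw [finMatrix_mul_apply, finsum_eq_single _ i]
  · simp [finSingle_apply]
  · intro m hm
    simp [finSingle_apply, hm]

theorem finSingle_mul_finSingle (i j l : I) (a b : R) :
    finSingle i j a * finSingle j l b = finSingle i l (a * b) := by
  apply finMatrix_ext
  intro k m
  rw [finSingle_mul_apply, finSingle_apply, finSingle_apply]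
  by_cases hk : k = i <;> by_cases hm : m = l <;> simp [hk, hm]

theorem finSingle_mul_finSingle_of_ne {j k : I} (h : j ≠ k) (i l : I) (a b : R) :
    finSingle i j a * finSingle k l b = 0 := by
  apply finMatrix_ext
  intro p q
  rw [finSingle_mul_apply, finSingle_apply, finMatrix_zero_apply]
  simp [h]

theorem finSingle_mul_mul_finSingle (i j k l : I) (a b : R) (A : FinMatrix I R) :
    finSingle i j a * A * finSingle k l b = finSingle i l (a * (A : Matrix I I R) j k * b) := by
  apply finMatrix_ext
  intro p q
  rw [mul_finSingle_apply, finSingle_mul_apply, finSingle_apply]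
  by_cases hk : p = i <;> by_cases hm : q = l <;> simp [hk, hm]

theorem finSingle_add (i j : I) (a b : R) :
    finSingle i j (a + b) = finSingle i j a + finSingle i j b := by
  apply finMatrix_ext
  intro p q
  rw [finMatrix_add_apply]
  simp only [finSingle_apply]
  split <;> simp

@[simp] theorem finSingle_zero (i j : I) : finSingle i j (0 : R) = 0 := by
  apply finMatrix_ext
  intro p q
  rw [finMatrix_zero_apply]
  simp [finSingle_apply]

theorem finSingle_injective (i j : I) : Function.Injective (finSingle i j : R → FinMatrix I R) := by
  intro a b h
  rw [← finSingle_same i j a, h, finSingle_same]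

theorem finMatrix_sum_apply {A : Type*} (t : Finset A) (f : A → FinMatrix I R) (i j : I) :
    ((∑ p ∈ t, f p : FinMatrix I R) : Matrix I I R) i j = ∑ p ∈ t, (f p : Matrix I I R) i j := by
  rw [AddSubgroup.val_finsetSum, Matrix.sum_apply]

theorem finMatrix_mem_of_finSingle_mem (N : AddSubgroup (FinMatrix I R))
    (h : ∀ i j a, finSingle i j a ∈ N) (A : FinMatrix I R) : A ∈ N := by
  classical
  obtain ⟨s, hs⟩ := finMatrix_exists_finset A
  have : A = ∑ p ∈ s ×ˢ s, finSingle p.1 p.2 ((A : Matrix I I R) p.1 p.2) := by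
    apply finMatrix_ext
    intro i j
    rw [finMatrix_sum_apply]
    by_cases hA : (A : Matrix I I R) i j = 0
    · rw [hA, Finset.sum_eq_zero]
      intro p _
      rw [finSingle_apply]
      split_ifs with hp
      · rw [← hp.1, ← hp.2, hA]
      · rfl
    · rw [Finset.sum_eq_single (i, j)]
      · rw [finSingle_same]
      · rintro ⟨k, l⟩ - hp
        rw [finSingle_apply, if_neg]
        rintro ⟨rfl, rfl⟩
        exact hp rfl
      · intro hp
        exact absurd (by simpa using hs i j hA) hp
  rw [this]
  exact sum_mem fun p _ => h _ _ _

end FinSingle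

/-! ### Degrees in graded matrix rings -/

section MatrixDegrees

variable {C : Type*} [Groupoid C] {D I : Type*} [NonUnitalRing D] {e : C}

/-- The family `(σ_i)` in `e Γ` given by morphisms `s i : d(σ_i) ⟶ e`. -/
def homFam {x : I → C} (s : ∀ i, x i ⟶ e) : I → Arr C := fun i => ⟨x i, e, s i⟩

/-- The transport along `r(σ_i) = e` is paid once here; afterwards all degrees share the codomain
`e` by definition. -/
theorem exists_eq_homFam {σ : I → Arr C} (h : ∀ i, (σ i).r = e) :
    ∃ (x : I → C) (s : ∀ i, x i ⟶ e), σ = homFam s := by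
  refine ⟨fun i => (σ i).d, fun i => (σ i).hom ≫ eqToHom (h i), funext fun i => ?_⟩
  have hi := h i
  change σ i = ⟨(σ i).d, e, (σ i).hom ≫ eqToHom hi⟩
  generalize σ i = τ at hi ⊢
  obtain ⟨a, b, t⟩ := τ
  subst hi
  simp

/-- Solving `σγτ⁻¹ = α` for `γ` gives `γ = σ⁻¹ατ`. The zero element is exempted since it lies in
every component, even when the product is undefined. -/
theorem mem_compAt_pmul₃_iff {𝓓 : GroupoidGrading C D} {p q : C} (s : p ⟶ e) (t : q ⟶ e)
    {γ : Arr C} {a : D} :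
    a ∈ compAt 𝓓.comp (pmul₃ ⟨p, e, s⟩ γ (invArr ⟨q, e, t⟩)) ↔
      (a ≠ 0 → ∃ α : e ⟶ e, a ∈ 𝓓.comp ⟨e, e, α⟩ ∧ γ = ⟨q, p, t ≫ α ≫ Groupoid.inv s⟩) := by
  constructor
  · intro ha h0
    by_cases h : γ.r = p ∧ q = γ.d
    · obtain ⟨b, c, g⟩ := γ
      obtain ⟨rfl, rfl⟩ := h
      rw [invArr, pmul₃_mk] at ha
      exact ⟨_, ha, by simp⟩
    · rw [pmul₃_eq_none h] at ha
      exact absurd ha h0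
  · intro h
    by_cases h0 : a = 0
    · rw [h0]
      exact zero_mem _
    · obtain ⟨α, hα, rfl⟩ := h h0
      rw [invArr, pmul₃_mk]
      change a ∈ 𝓓.comp _
      simpa using hα

variable {𝓓 : GroupoidGrading C D} {x : I → C} {s : ∀ i, x i ⟶ e}

theorem mem_matrixComp_homFam {γ : Arr C} {A : FinMatrix I D} :
    A ∈ matrixComp 𝓓 (homFam s) γ ↔ ∀ i j, (A : Matrix I I D) i j ≠ 0 →
      ∃ α : e ⟶ e, (A : Matrix I I D) i j ∈ 𝓓.comp ⟨e, e, α⟩ ∧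
        γ = ⟨x j, x i, s j ≫ α ≫ Groupoid.inv (s i)⟩ :=
  forall₂_congr fun i j => mem_compAt_pmul₃_iff (s i) (s j)

theorem finSingle_mem_matrixComp (i j : I) {α : e ⟶ e} {a : D} (ha : a ∈ 𝓓.comp ⟨e, e, α⟩) :
    finSingle i j a ∈ matrixComp 𝓓 (homFam s) ⟨x j, x i, s j ≫ α ≫ Groupoid.inv (s i)⟩ := by
  rw [mem_matrixComp_homFam]
  intro k l h
  rw [finSingle_apply] at h ⊢
  split_ifs at h ⊢ with h'
  · obtain ⟨rfl, rfl⟩ := h'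
    exact ⟨α, ha, rfl⟩
  · exact absurd rfl h

theorem finSingle_one_mem (i j : I) :
    finSingle i j (𝓓.one e) ∈ matrixComp 𝓓 (homFam s) ⟨x j, x i, s j ≫ Groupoid.inv (s i)⟩ := by
  have := finSingle_mem_matrixComp (𝓓 := 𝓓) (s := s) i j (𝓓.one_mem e)
  rwa [Category.id_comp] at this

theorem finSingle_one_mem_id (i : I) :
    finSingle i i (𝓓.one e) ∈ matrixComp 𝓓 (homFam s) (idArr (x i)) := by
  have := finSingle_one_mem (𝓓 := 𝓓) (s := s) i i
  rwa [Groupoid.comp_inv] at this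

theorem matrixComp_mul_mem (hσ : DFinite (homFam s)) {a b c : C} {g : b ⟶ c} {f : a ⟶ b}
    {A B : FinMatrix I D} (hA : A ∈ matrixComp 𝓓 (homFam s) ⟨b, c, g⟩)
    (hB : B ∈ matrixComp 𝓓 (homFam s) ⟨a, b, f⟩) :
    A * B ∈ matrixComp 𝓓 (homFam s) ⟨a, c, f ≫ g⟩ := by
  have := (matrixPreGrading 𝓓 (homFam s) hσ).mul_mem hA hB
  rwa [pmul_mk] at this

/-- A homogeneous entry at any position gives a homogeneous matrix, as `σ_i⁻¹ασ_j` is always defined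
for `α ∈ e Γ e`. One may therefore compute in the whole ring `FinMatrix I D` instead of a subring.
-/
theorem matrix_subring_eq_top (hD : 𝓓.SupportedAt e) (hσ : DFinite (homFam s)) :
    (matrixPreGrading 𝓓 (homFam s) hσ).subring = ⊤ := by
  rw [eq_top_iff]
  rintro A -
  refine finMatrix_mem_of_finSingle_mem
    (⨆ γ, (matrixPreGrading 𝓓 (homFam s) hσ).comp γ) (fun i j a => ?_) A
  refine hD.induction (p := fun a => finSingle i j a ∈ _) a (fun α b hb => ?_) ?_ ?_
  · exact (matrixPreGrading 𝓓 (homFam s) hσ).comp_le (finSingle_mem_matrixComp i j hb)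
  · rw [finSingle_zero]
    exact zero_mem _
  · intro b c hb hc
    rw [finSingle_add]
    exact add_mem hb hc

/-- The graded ring `M_I(D)(σ)` on the ring of all matrices with finitely many nonzero entries, for
`supp D ⊆ e Γ e` and `σ` in `e Γ`. -/
noncomputable def fullMatrix (hD : 𝓓.SupportedAt e) (hσ : DFinite (homFam s)) :
    GroupoidGrading C (FinMatrix I D) :=
  (matrixPreGrading 𝓓 (homFam s) hσ).ofTop (matrix_subring_eq_top hD hσ)

theorem grMatrix_grIso_fullMatrix (hD : 𝓓.SupportedAt e) (hσ : DFinite (homFam s)) :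
    (grMatrix 𝓓 (homFam s) hσ).GrIso (fullMatrix hD hσ) :=
  PreGrading.grIso_ofTop _ _

end MatrixDegrees

end GroupoidGraded

namespace GroupoidGraded

/-! ### Gr-simplicity of graded matrix rings -/

namespace GroupoidGrading

variable {C : Type*} [Groupoid C] {R S : Type*} [NonUnitalRing R] [NonUnitalRing S]

theorem IsGrSimple.of_grIso {𝓡 : GroupoidGrading C R} {𝓢 : GroupoidGrading C S}
    (hR : 𝓡.IsGrSimple) (h : 𝓡.GrIso 𝓢) : 𝓢.IsGrSimple := by
  obtain ⟨φ, hφ, -⟩ := h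
  obtain ⟨⟨a, ha⟩, h⟩ := hR
  refine ⟨⟨φ a, by simpa using ha⟩, fun N hN => ?_⟩
  have hM : 𝓡.IsGradedIdeal (N.comap (φ : R →+ S)) := by
    refine ⟨fun r x hx => ?_, le_antisymm (fun x hx => ?_) (iSup_le fun γ => inf_le_left)⟩
    · have := hN.1 (φ r) (φ x) hx
      exact ⟨show φ (r * x) ∈ N by rw [map_mul]; exact this.1,
        show φ (x * r) ∈ N by rw [map_mul]; exact this.2⟩
    · have hx' : φ x ∈ ⨆ γ, N ⊓ 𝓢.comp γ := hN.2 ▸ hx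
      rw [← φ.symm_apply_apply x]
      refine AddSubgroup.iSup_induction (fun γ => N ⊓ 𝓢.comp γ)
        (C := fun b => φ.symm b ∈ ⨆ γ, N.comap (φ : R →+ S) ⊓ 𝓡.comp γ) hx' ?_ ?_ ?_
      · intro γ b hb
        refine le_iSup (fun γ => N.comap (φ : R →+ S) ⊓ 𝓡.comp γ) γ
          ⟨?_, symm_mem_comp φ hφ hb.2⟩
        change φ (φ.symm b) ∈ N
        rw [φ.apply_symm_apply]
        exact hb.1
      · rw [map_zero]
        exact zero_mem _
      · intro b c hb hc
        rw [map_add]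
        exact add_mem hb hc
  rcases h _ hM with h' | h'
  · left
    rw [AddSubgroup.eq_bot_iff_forall] at h' ⊢
    intro b hb
    simpa using h' (φ.symm b) (show φ (φ.symm b) ∈ N by simpa using hb)
  · right
    rw [eq_top_iff]
    rintro b -
    have : φ.symm b ∈ N.comap (φ : R →+ S) := by rw [h']; trivial
    simpa using this

end GroupoidGrading

section Simple

variable {C : Type*} [Groupoid C] {D I : Type*} [NonUnitalRing D] {e : C}
  {𝓓 : GroupoidGrading C D} {x : I → C} {s : ∀ i, x i ⟶ e}

/-- A nonzero graded ideal contains a nonzero homogeneous matrix; any nonzero entry of it is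
homogeneous, hence invertible, and can be moved to any position and scaled to any value by
multiplying on both sides. -/
theorem isGrSimple_fullMatrix [Nonempty I] (hdiv : 𝓓.IsGrDivision) (hD : 𝓓.SupportedAt e)
    (hσ : DFinite (homFam s)) : (fullMatrix hD hσ).IsGrSimple := by
  obtain ⟨i₀⟩ := ‹Nonempty I›
  refine ⟨⟨finSingle i₀ i₀ (𝓓.one e), fun h => hdiv.one_ne_zero hD ?_⟩, fun N hN => ?_⟩
  · exact finSingle_injective i₀ i₀ (h.trans (finSingle_zero i₀ i₀).symm)
  by_cases h : ∃ γ, ∃ A ∈ N, A ∈ (fullMatrix hD hσ).comp γ ∧ A ≠ 0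
  · right
    obtain ⟨γ, A, hAN, hA, hA0⟩ := h
    obtain ⟨i, j, hij⟩ : ∃ i j, (A : Matrix I I D) i j ≠ 0 := by
      by_contra! h'
      exact hA0 (finMatrix_ext h')
    obtain ⟨α, hα, -⟩ := mem_matrixComp_homFam.1 hA i j hij
    obtain ⟨b, -, -, hb⟩ := hdiv.exists_inv hα hij
    rw [eq_top_iff]
    rintro B -
    refine finMatrix_mem_of_finSingle_mem N (fun k l c => ?_) B
    have : finSingle k l c = finSingle k i (c * b) * A * finSingle j l (𝓓.one e) := by
      rw [finSingle_mul_mul_finSingle, mul_assoc c, hb, hD.mul_one, hD.mul_one]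
    rw [this]
    exact (hN.1 _ _ (hN.1 _ _ hAN).1).2
  · left
    push Not at h
    rw [hN.2, eq_bot_iff]
    exact iSup_le fun γ A hA => h γ A hA.1 hA.2

theorem isGrSimple_grMatrix [Nonempty I] (hdiv : 𝓓.IsGrDivision) (hD : 𝓓.SupportedAt e)
    {σ : I → Arr C} (hr : ∀ i, (σ i).r = e) (hσ : DFinite σ) : (grMatrix 𝓓 σ hσ).IsGrSimple := by
  obtain ⟨x, s, rfl⟩ := exists_eq_homFam hr
  exact (isGrSimple_fullMatrix hdiv hD hσ).of_grIso (grMatrix_grIso_fullMatrix hD hσ).symm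

end Simple

/-! ### Shifts `M_1(D)(τ⁻¹)` and conjugation of matrix rings -/

section UnitMatrix

variable {C : Type*} [Groupoid C] {D D' : Type*} [NonUnitalRing D] [NonUnitalRing D'] {e e' : C}
  {𝓓 : GroupoidGrading C D} {𝓓' : GroupoidGrading C D'}

/-- The ring of `1 × 1` matrices. -/
noncomputable def finMatrixUnit (R : Type*) [NonUnitalRing R] : FinMatrix Unit R ≃+* R where
  toFun A := (A : Matrix Unit Unit R) () ()
  invFun a := finSingle () () a
  left_inv A := finMatrix_ext fun _ _ => finSingle_same _ _ _
  right_inv a := finSingle_same _ _ _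
  map_mul' A B := by rw [finMatrix_mul_apply, finsum_unique]
  map_add' A B := rfl

/-- The component of `M_1(D)(τ⁻¹)` at `γ` is `D_{τ⁻¹γτ}`, so an isomorphism with this ring amounts
to a ring isomorphism `D ≃ D'` taking degree `α` to `τατ⁻¹`. -/
theorem grIso_grMatrixOne (hD : 𝓓.SupportedAt e) (t : e ⟶ e') (ψ : D ≃+* D')
    (hψ : ∀ (α : e ⟶ e), ∀ a ∈ 𝓓.comp ⟨e, e, α⟩, ψ a ∈ 𝓓'.comp ⟨e', e', Groupoid.inv t ≫ α ≫ t⟩) :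
    𝓓'.GrIso (grMatrixOne 𝓓 (invArr ⟨e, e', t⟩)) := by
  refine GroupoidGrading.GrIso.symm (GroupoidGrading.GrIso.trans
    (grMatrix_grIso_fullMatrix (s := fun _ : Unit => Groupoid.inv t) hD (DFinite.of_finite _))
    (GroupoidGrading.GrIso.of_ringEquiv ((finMatrixUnit D).trans ψ) fun γ A hA => ?_))
  change ψ ((A : Matrix Unit Unit D) () ()) ∈ _
  by_cases h0 : (A : Matrix Unit Unit D) () () = 0
  · rw [h0, map_zero]
    exact zero_mem _
  · obtain ⟨α, hα, rfl⟩ := mem_matrixComp_homFam.1 hA () () h0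
    simpa using hψ α _ hα

theorem exists_ringEquiv_of_grIso_grMatrixOne (hD : 𝓓.SupportedAt e) (t : e ⟶ e')
    (h : 𝓓'.GrIso (grMatrixOne 𝓓 (invArr ⟨e, e', t⟩))) :
    ∃ ψ : D ≃+* D', ∀ (α : e ⟶ e) (a : D),
      ψ a ∈ 𝓓'.comp ⟨e', e', Groupoid.inv t ≫ α ≫ t⟩ ↔ a ∈ 𝓓.comp ⟨e, e, α⟩ := by
  obtain ⟨φ, hφ, -⟩ := h.trans
    (grMatrix_grIso_fullMatrix (s := fun _ : Unit => Groupoid.inv t) hD (DFinite.of_finite _))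
  refine ⟨(φ.trans (finMatrixUnit D)).symm, fun α a => ⟨fun ha => ?_, fun ha => ?_⟩⟩
  · have h1 := hφ _ _ ha
    rw [show φ ((φ.trans (finMatrixUnit D)).symm a) = finSingle () () a from
      φ.apply_symm_apply _] at h1
    have h2 := mem_matrixComp_homFam.1 h1 () ()
    rw [finSingle_same] at h2
    by_cases h0 : a = 0
    · rw [h0]
      exact zero_mem _
    · obtain ⟨β, hβ, h3⟩ := h2 h0
      injection h3 with _ _ h3
      have : α = β := by simpa [cancel_mono] using h3
      rwa [this]
  · have h1 := finSingle_mem_matrixComp (s := fun _ : Unit => Groupoid.inv t) () () ha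
    have h2 := GroupoidGrading.symm_mem_comp φ hφ h1
    change φ.symm (finSingle () () a) ∈ _
    simpa using h2

end UnitMatrix

section Conjugation

variable {I I' R S : Type*} [NonUnitalRing R] [NonUnitalRing S]

/-- The isomorphism `(a_ij) ↦ (ψ(u_i a_ij v_j))` of matrix rings, where `u_i` and `v_i` are inverse
to each other. -/
noncomputable def finMatrixConj (π : I ≃ I') (ψ : R ≃+* S) (u v : I → R)
    (huv : ∀ i a, u i * (v i * a) = a) (hvu : ∀ i a, v i * (u i * a) = a)
    (huv' : ∀ i a, a * u i * v i = a) (hvu' : ∀ i a, a * v i * u i = a) :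
    FinMatrix I R ≃+* FinMatrix I' S where
  toFun A := ⟨fun k l => ψ (u (π.symm k) * (A : Matrix I I R) (π.symm k) (π.symm l)
      * v (π.symm l)), by
    refine (Set.Finite.image (Equiv.prodCongr π π) A.2).subset fun p hp => ?_
    refine ⟨(π.symm p.1, π.symm p.2), fun h => hp ?_, by simp⟩
    dsimp only at h ⊢
    rw [h, mul_zero, zero_mul, map_zero]⟩
  invFun B := ⟨fun i j => v i * ψ.symm ((B : Matrix I' I' S) (π i) (π j)) * u j, by
    refine (Set.Finite.image (Equiv.prodCongr π.symm π.symm) B.2).subset fun p hp => ?_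
    refine ⟨(π p.1, π p.2), fun h => hp ?_, by simp⟩
    dsimp only at h ⊢
    rw [h, map_zero, mul_zero, zero_mul]⟩
  left_inv A := by
    apply finMatrix_ext
    intro i j
    change v i * ψ.symm (ψ (u (π.symm (π i)) * (A : Matrix I I R) (π.symm (π i)) (π.symm (π j))
      * v (π.symm (π j)))) * u j = _
    simp only [Equiv.symm_apply_apply, RingEquiv.symm_apply_apply]
    rw [mul_assoc, hvu', hvu]
  right_inv B := by
    apply finMatrix_ext
    intro k l
    change ψ (u (π.symm k) * (v (π.symm k) * ψ.symm ((B : Matrix I' I' S) (π (π.symm k))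
      (π (π.symm l))) * u (π.symm l)) * v (π.symm l)) = _
    simp only [Equiv.apply_symm_apply]
    rw [← mul_assoc, huv', huv, RingEquiv.apply_symm_apply]
  map_mul' A B := by
    apply finMatrix_ext
    intro k l
    obtain ⟨s, hs⟩ := finMatrix_exists_finset A
    change ψ (u (π.symm k) * ((A * B : FinMatrix I R) : Matrix I I R) (π.symm k) (π.symm l)
      * v (π.symm l)) = ∑ᶠ m, ψ _ * ψ _
    rw [finMatrix_mul_eq A B s hs, Finset.mul_sum, Finset.sum_mul, map_sum,
      finsum_eq_sum_of_support_subset (s := s.map π.toEmbedding), Finset.sum_map]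
    · refine Finset.sum_congr rfl fun m _ => ?_
      rw [← map_mul]
      simp only [Equiv.coe_toEmbedding, Equiv.symm_apply_apply]
      congr 1
      simp only [mul_assoc]
      rw [hvu]
    · intro m hm
      have : (A : Matrix I I R) (π.symm k) (π.symm m) ≠ 0 := by
        intro h
        apply hm
        simp [h]
      simpa using (hs _ _ this).2
  map_add' A B := by
    apply finMatrix_ext
    intro k l
    change ψ (u (π.symm k) * ((A : Matrix I I R) (π.symm k) (π.symm l)
      + (B : Matrix I I R) (π.symm k) (π.symm l)) * v (π.symm l)) = _
    rw [mul_add, add_mul, map_add]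
    rfl

theorem finMatrixConj_apply (π : I ≃ I') (ψ : R ≃+* S) (u v : I → R)
    (huv : ∀ i a, u i * (v i * a) = a) (hvu : ∀ i a, v i * (u i * a) = a)
    (huv' : ∀ i a, a * u i * v i = a) (hvu' : ∀ i a, a * v i * u i = a) (A : FinMatrix I R)
    (i j : I) : (finMatrixConj π ψ u v huv hvu huv' hvu' A : Matrix I' I' S) (π i) (π j)
      = ψ (u i * (A : Matrix I I R) i j * v j) := by
  change ψ (u (π.symm (π i)) * (A : Matrix I I R) (π.symm (π i)) (π.symm (π j))
      * v (π.symm (π j))) = _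
  simp only [Equiv.symm_apply_apply]

end Conjugation

/-! ### Sufficiency of the matching condition -/

section Sufficiency

variable {C : Type*} [Groupoid C] {D D' I I' : Type*} [NonUnitalRing D] [NonUnitalRing D'] {e e' : C}
  {𝓓 : GroupoidGrading C D} {𝓓' : GroupoidGrading C D'}
  {x : I → C} {s : ∀ i, x i ⟶ e} {x' : I' → C} {s' : ∀ i, x' i ⟶ e'}

theorem memTranslate_supp_iff (hD : 𝓓.SupportedAt e) {y z : C} (t : e ⟶ e') (f : y ⟶ e)
    (g : z ⟶ e') : MemTranslate ⟨e, e', t⟩ 𝓓.supp ⟨y, e, f⟩ ⟨z, e', g⟩ ↔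
      ∃ α : e ⟶ e, 𝓓.comp ⟨e, e, α⟩ ≠ ⊥ ∧ (⟨y, e', f ≫ α ≫ t⟩ : Arr C) = ⟨z, e', g⟩ := by
  constructor
  · rintro ⟨⟨a, b, α⟩, hα, h⟩
    obtain ⟨h1, h2⟩ := hD _ hα
    dsimp only at h1 h2
    subst h1 h2
    rw [pmul₃_mk] at h
    exact ⟨α, hα, Option.some.inj h⟩
  · rintro ⟨α, hα, h⟩
    exact ⟨⟨e, e, α⟩, hα, by rw [pmul₃_mk, h]⟩

/-- The domains need only be propositionally equal, so the substitution is made at the level of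
`Arr`, where it requires no transport. -/
theorem arr_conj_congr {p p' q q' : C} {f : p ⟶ e} {f' : p' ⟶ e} {g : q ⟶ e} {g' : q' ⟶ e}
    (hf : (⟨p, e, f⟩ : Arr C) = ⟨p', e, f'⟩) (hg : (⟨q, e, g⟩ : Arr C) = ⟨q', e, g'⟩) (β : e ⟶ e) :
    (⟨q, p, g ≫ β ≫ Groupoid.inv f⟩ : Arr C) = ⟨q', p', g' ≫ β ≫ Groupoid.inv f'⟩ := by
  cases hf
  cases hg
  rfl

theorem grIso_grMatrix_of_memTranslate (hdiv : 𝓓.IsGrDivision) (hD : 𝓓.SupportedAt e)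
    (hD' : 𝓓'.SupportedAt e') (hσ : DFinite (homFam s)) (hδ : DFinite (homFam s')) (π : I ≃ I')
    (t : e ⟶ e') (h : 𝓓'.GrIso (grMatrixOne 𝓓 (invArr ⟨e, e', t⟩)))
    (hπ : ∀ i, MemTranslate ⟨e, e', t⟩ 𝓓.supp (homFam s i) (homFam s' (π i))) :
    (grMatrix 𝓓 (homFam s) hσ).GrIso (grMatrix 𝓓' (homFam s') hδ) := by
  obtain ⟨ψ, hψ⟩ := exists_ringEquiv_of_grIso_grMatrixOne hD t h
  choose ω hω hωs using fun i => (memTranslate_supp_iff hD t (s i) (s' (π i))).1 (hπ i)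
  -- Here `u_i` is a nonzero element of `D_{ω_i}`, where `δ_{π(i)} = τ ω_i σ_i`, and `v_i` is its
  -- inverse.
  choose u hu hu0 using fun i => (AddSubgroup.ne_bot_iff_exists_ne_zero.1 (hω i)).imp
    fun a ha => And.intro a.2 fun h0 => ha (Subtype.ext h0)
  choose v hv huv hvu using fun i => hdiv.exists_inv (hu i) (hu0 i)
  refine GroupoidGrading.GrIso.trans (grMatrix_grIso_fullMatrix hD hσ)
    (GroupoidGrading.GrIso.trans (GroupoidGrading.GrIso.of_ringEquiv
      (finMatrixConj π ψ (fun i => u i) v ?_ ?_ ?_ ?_) fun γ A hA => ?_)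
      (grMatrix_grIso_fullMatrix hD' hδ).symm)
  · intro i a
    rw [← mul_assoc, huv, hD.one_mul]
  · intro i a
    rw [← mul_assoc, hvu, hD.one_mul]
  · intro i a
    rw [mul_assoc, huv, hD.mul_one]
  · intro i a
    rw [mul_assoc, hvu, hD.mul_one]
  · refine mem_matrixComp_homFam.2 fun k l => ?_
    obtain ⟨i, rfl⟩ := π.surjective k
    obtain ⟨j, rfl⟩ := π.surjective l
    rw [finMatrixConj_apply]
    intro h0
    have hA0 : (A : Matrix I I D) i j ≠ 0 := by
      intro h1
      apply h0
      rw [h1, mul_zero, zero_mul, map_zero]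
    obtain ⟨α, hα, rfl⟩ := mem_matrixComp_homFam.1 hA i j hA0
    -- The new entry has degree `τ ω_i α ω_j⁻¹ τ⁻¹`; conjugation by `δ_{π(i)} = τ ω_i σ_i` and
    -- `δ_{π(j)}` cancels everything but `σ_i⁻¹ασ_j`.
    refine ⟨_, (hψ _ _).2 (𝓓.mul_mem_hom (𝓓.mul_mem_hom (hu i) hα) (hv j)), ?_⟩
    rw [← arr_conj_congr (hωs i) (hωs j)]
    simp

end Sufficiency

end GroupoidGraded

namespace GroupoidGraded

/-! ### Counting degrees in cosets of the support -/

section Cosets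

variable {C : Type*} [Groupoid C] {D : Type*} [NonUnitalRing D] {e : C} {𝓓 : GroupoidGrading C D}

/-- `ρ ∈ (supp D) a`, for `supp D ⊆ e Γ e` and `a` in `e Γ`. -/
def InCoset (𝓓 : GroupoidGrading C D) (ρ : Arr C) {y : C} (a : y ⟶ e) : Prop :=
  ∃ α : e ⟶ e, 𝓓.comp ⟨e, e, α⟩ ≠ ⊥ ∧ ρ = ⟨y, e, a ≫ α⟩

theorem exists_mem_ne_zero {H : AddSubgroup D} (h : H ≠ ⊥) : ∃ a ∈ H, a ≠ 0 := by
  obtain ⟨a, ha⟩ := AddSubgroup.ne_bot_iff_exists_ne_zero.1 h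
  exact ⟨a, a.2, fun h0 => ha (Subtype.ext h0)⟩

theorem comp_ne_bot {γ : Arr C} {a : D} (ha : a ∈ 𝓓.comp γ) (h0 : a ≠ 0) : 𝓓.comp γ ≠ ⊥ := by
  intro h
  rw [h] at ha
  exact h0 (AddSubgroup.mem_bot.1 ha)

theorem inCoset_self (hdiv : 𝓓.IsGrDivision) (hD : 𝓓.SupportedAt e) {y : C} (a : y ⟶ e) :
    InCoset 𝓓 ⟨y, e, a⟩ a :=
  ⟨𝟙 e, comp_ne_bot (𝓓.one_mem e) (hdiv.one_ne_zero hD), by rw [Category.comp_id]⟩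

/-- The relation `b ∈ (supp D) a` is symmetric and transitive. -/
theorem InCoset.of_common (hdiv : 𝓓.IsGrDivision) (hD : 𝓓.SupportedAt e) {y z : C} {a : y ⟶ e}
    {b : z ⟶ e} {ρ ρ' : Arr C} (ha : InCoset 𝓓 ρ a) (hb : InCoset 𝓓 ρ b) (ha' : InCoset 𝓓 ρ' a) :
    InCoset 𝓓 ρ' b := by
  obtain ⟨α, hα, rfl⟩ := ha
  obtain ⟨β, hβ, h⟩ := hb
  obtain ⟨α', hα', rfl⟩ := ha'
  obtain ⟨u, hu, hu0⟩ := exists_mem_ne_zero hα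
  obtain ⟨v, hv, hv0⟩ := exists_mem_ne_zero hβ
  obtain ⟨w, hw, hw0⟩ := exists_mem_ne_zero hα'
  obtain ⟨u', hu', -, h1⟩ := hdiv.exists_inv hu hu0
  have hu'0 : u' ≠ 0 := by
    rintro rfl
    exact hdiv.one_ne_zero hD (by rw [← h1, zero_mul])
  refine ⟨_, comp_ne_bot (𝓓.mul_mem_hom hw (𝓓.mul_mem_hom hu' hv))
    (hdiv.mul_ne_zero hD hw hw0 (hdiv.mul_ne_zero hD hu' hu'0 hv0)), ?_⟩
  obtain rfl : y = z := by injection h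
  have h2 : a ≫ α = b ≫ β := by injection h
  have h3 : a = b ≫ β ≫ Groupoid.inv α := by
    rw [← Category.assoc, ← h2]
    simp
  rw [h3]
  simp

theorem InCoset.d_eq {ρ : Arr C} {y : C} {a : y ⟶ e} (h : InCoset 𝓓 ρ a) : y = ρ.d := by
  obtain ⟨α, -, rfl⟩ := h
  rfl

/-- Cosets, taken as sets, label the classes of the equivalence relation; this lets bijections be
assembled fibre by fibre. -/
theorem inCoset_set_eq_iff (hdiv : 𝓓.IsGrDivision) (hD : 𝓓.SupportedAt e) {y z : C} {a : y ⟶ e}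
    {b : z ⟶ e} : {ρ | InCoset 𝓓 ρ b} = {ρ | InCoset 𝓓 ρ a} ↔ InCoset 𝓓 ⟨y, e, a⟩ b := by
  constructor
  · intro h
    have : (⟨y, e, a⟩ : Arr C) ∈ {ρ | InCoset 𝓓 ρ b} := by
      rw [h]
      exact inCoset_self hdiv hD a
    exact this
  · intro h
    ext ρ
    exact ⟨fun h' => h.of_common hdiv hD (inCoset_self hdiv hD a) h',
      fun h' => (inCoset_self hdiv hD a).of_common hdiv hD h h'⟩

theorem inCoset_comp {ya yb : C} {a : ya ⟶ e} {b : yb ⟶ e} {α ω : e ⟶ e} {ρ : Arr C}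
    (h : (⟨yb, e, b ≫ α⟩ : Arr C) = ⟨ya, e, a⟩) (hω : ρ = ⟨ya, e, a ≫ ω⟩) :
    ρ = ⟨yb, e, b ≫ α ≫ ω⟩ := by
  cases h
  rw [hω, Category.assoc]

theorem arr_comp_left_cancel {y : C} {a : y ⟶ e} {α β : e ⟶ e}
    (h : (⟨y, e, a ≫ α⟩ : Arr C) = ⟨y, e, a ≫ β⟩) : α = β := by
  have : a ≫ α = a ≫ β := by injection h
  simpa [cancel_epi] using this

/-- If `ρ = ωa = ω'b` and `αb = a`, then `ωα = ω'`, so `uXv` has degree `ωαω'⁻¹ = e`. This turns a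
block of homogeneous entries of various degrees into a matrix over `D_e`. -/
theorem normalized_mem {ya yb : C} {a : ya ⟶ e} {b : yb ⟶ e} {ω ω' : e ⟶ e} {ρ : Arr C}
    (hω : ρ = ⟨ya, e, a ≫ ω⟩) (hω' : ρ = ⟨yb, e, b ≫ ω'⟩) {u v X : D} (hu : u ∈ 𝓓.comp ⟨e, e, ω⟩)
    (hv : v ∈ 𝓓.comp ⟨e, e, Groupoid.inv ω'⟩)
    (hX : X ≠ 0 → ∃ α : e ⟶ e, X ∈ 𝓓.comp ⟨e, e, α⟩ ∧ (⟨yb, e, b ≫ α⟩ : Arr C) = ⟨ya, e, a⟩) :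
    u * X * v ∈ 𝓓.comp (idArr e) := by
  by_cases h0 : X = 0
  · rw [h0, mul_zero, zero_mul]
    exact zero_mem _
  · obtain ⟨α, hα, h⟩ := hX h0
    have h1 : α ≫ ω = ω' := arr_comp_left_cancel ((inCoset_comp h hω).symm.trans hω')
    have h2 := 𝓓.mul_mem_hom (𝓓.mul_mem_hom hu hα) hv
    rw [h1, Groupoid.inv_comp] at h2
    exact h2

/-- A homogeneous right invertible matrix has, in each coset of `supp D`, at most as many row degrees
as column degrees. -/
theorem card_inCoset_le (hdiv : 𝓓.IsGrDivision) (hD : 𝓓.SupportedAt e) {A B : Type*}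
    {ya : A → C} {yb : B → C} (a : ∀ i, ya i ⟶ e) (b : ∀ l, yb l ⟶ e) (X : A → B → D)
    (Y : B → A → D)
    (hX : ∀ i l, X i l ≠ 0 → ∃ α : e ⟶ e, X i l ∈ 𝓓.comp ⟨e, e, α⟩ ∧
      (⟨yb l, e, b l ≫ α⟩ : Arr C) = ⟨ya i, e, a i⟩)
    (hY : ∀ l i, Y l i ≠ 0 → ∃ α : e ⟶ e, Y l i ∈ 𝓓.comp ⟨e, e, α⟩ ∧
      (⟨ya i, e, a i ≫ α⟩ : Arr C) = ⟨yb l, e, b l⟩)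
    (hXY : ∀ i, ∑ᶠ l, X i l * Y l i = 𝓓.one e)
    (hXY' : ∀ i i', i ≠ i' → ∑ᶠ l, X i l * Y l i' = 0) (ρ : Arr C)
    [Finite {i // InCoset 𝓓 ρ (a i)}] [Finite {l // InCoset 𝓓 ρ (b l)}] :
    Nat.card {i // InCoset 𝓓 ρ (a i)} ≤ Nat.card {l // InCoset 𝓓 ρ (b l)} := by
  classical
  have := Fintype.ofFinite {i // InCoset 𝓓 ρ (a i)}
  have := Fintype.ofFinite {l // InCoset 𝓓 ρ (b l)}
  rw [Nat.card_eq_fintype_card, Nat.card_eq_fintype_card]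
  choose ω hω hωρ using fun i : {i // InCoset 𝓓 ρ (a i)} => i.2
  choose ω' hω' hωρ' using fun l : {l // InCoset 𝓓 ρ (b l)} => l.2
  choose u hu hu0 using fun i => exists_mem_ne_zero (hω i)
  choose v hv hv0 using fun l => exists_mem_ne_zero (hω' l)
  choose u' hu' huu' _ using fun i => hdiv.exists_inv (hu i) (hu0 i)
  choose v' hv' _ hvv' using fun l => hdiv.exists_inv (hv l) (hv0 l)
  refine hdiv.card_le_of_mul_eq_one hD (fun i l => u i * X i l * v' l)
    (fun l i => v l * Y l i * u' i)
    (fun i l => normalized_mem (hωρ i) (hωρ' l) (hu i) (hv' l) (hX i l))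
    (fun l i => normalized_mem (hωρ' l) (hωρ i) (hv l) (hu' i) (hY l i)) fun i i' => ?_
  have hfin : {l | InCoset 𝓓 ρ (b l)}.Finite :=
    Set.finite_coe_iff.1 (inferInstanceAs (Finite {l // InCoset 𝓓 ρ (b l)}))
  -- A nonzero entry in a row of the coset lies in a column of the same coset, so restricting to the
  -- block loses no terms.
  have key : ∑ l : {l // InCoset 𝓓 ρ (b l)}, X i l * Y l i' = ∑ᶠ l, X i l * Y l i' := by
    rw [finsum_eq_sum_of_support_subset (s := hfin.toFinset),
      Finset.sum_subtype hfin.toFinset (p := fun l => InCoset 𝓓 ρ (b l))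
        (fun l => by rw [Set.Finite.mem_toFinset]; rfl)]
    intro l hl
    have hl0 : X i l ≠ 0 := left_ne_zero_of_mul hl
    obtain ⟨α, hα, h⟩ := hX i l hl0
    rw [Set.Finite.coe_toFinset]
    exact ⟨α ≫ ω i, comp_ne_bot (𝓓.mul_mem_hom (hu i) hα)
      (hdiv.mul_ne_zero hD (hu i) (hu0 i) hl0), inCoset_comp h (hωρ i)⟩
  -- The column scalings cancel inside the product; the row scalings only conjugate the identity.
  have h1 : ∀ l : {l // InCoset 𝓓 ρ (b l)}, u i * X i l * v' l * (v l * Y l i' * u' i')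
      = u i * (X i l * Y l i') * u' i' := by
    intro l
    have : v' l * (v l * (Y l i' * u' i')) = Y l i' * u' i' := by
      rw [← mul_assoc, hvv', hD.one_mul]
    simp only [mul_assoc, this]
  simp only [h1]
  rw [← Finset.sum_mul, ← Finset.mul_sum, key]
  split_ifs with hi
  · rw [← hi, hXY, hD.mul_one, huu']
  · rw [hXY' _ _ fun h => hi (Subtype.ext h), mul_zero, zero_mul]

/-- Families with equally many members in each coset of `supp D` agree up to a bijection and the
left action of `supp D`. -/
theorem exists_equiv_inCoset (hdiv : 𝓓.IsGrDivision) (hD : 𝓓.SupportedAt e) {A B : Type*}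
    {ya : A → C} {yb : B → C} (a : ∀ i, ya i ⟶ e) (b : ∀ l, yb l ⟶ e)
    [∀ ρ, Finite {i // InCoset 𝓓 ρ (a i)}] [∀ ρ, Finite {l // InCoset 𝓓 ρ (b l)}]
    (h : ∀ ρ, Nat.card {i // InCoset 𝓓 ρ (a i)} = Nat.card {l // InCoset 𝓓 ρ (b l)}) :
    ∃ π : A ≃ B, ∀ i, InCoset 𝓓 ⟨yb (π i), e, b (π i)⟩ (a i) := by
  have key : ∀ c : Set (Arr C), Nonempty ({i // {ρ | InCoset 𝓓 ρ (a i)} = c} ≃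
      {l // {ρ | InCoset 𝓓 ρ (b l)} = c}) := by
    intro c
    by_cases hc : ∃ (y : C) (f : y ⟶ e), c = {ρ | InCoset 𝓓 ρ f}
    · obtain ⟨y, f, rfl⟩ := hc
      obtain ⟨E⟩ := Finite.card_eq.1 (h ⟨y, e, f⟩)
      exact ⟨(Equiv.subtypeEquivRight fun i => inCoset_set_eq_iff hdiv hD).trans
        (E.trans (Equiv.subtypeEquivRight fun l => inCoset_set_eq_iff hdiv hD).symm)⟩
    -- A set that is not a coset labels an empty fibre on both sides.
    · have h1 : IsEmpty {i // {ρ | InCoset 𝓓 ρ (a i)} = c} :=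
        ⟨fun i => hc ⟨_, a i, i.2.symm⟩⟩
      have h2 : IsEmpty {l // {ρ | InCoset 𝓓 ρ (b l)} = c} :=
        ⟨fun l => hc ⟨_, b l, l.2.symm⟩⟩
      exact ⟨Equiv.equivOfIsEmpty _ _⟩
  refine ⟨Equiv.ofFiberEquiv fun c => (key c).some, fun i => ?_⟩
  have := Equiv.ofFiberEquiv_map (fun c => (key c).some) i
  exact (inCoset_set_eq_iff hdiv hD).1 this.symm

end Cosets

end GroupoidGraded

namespace GroupoidGraded

/-! ### Equivalence of idempotents under a graded isomorphism -/

section Necessity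

variable {C : Type*} [Groupoid C] {D D' I I' : Type*} [NonUnitalRing D] [NonUnitalRing D'] {e e' : C}
  {𝓓 : GroupoidGrading C D} {𝓓' : GroupoidGrading C D'}
  {x : I → C} {s : ∀ i, x i ⟶ e} {x' : I' → C} {s' : ∀ i, x' i ⟶ e'}

theorem matrixComp_mul_mem_idArr {a : C} (hσ : DFinite (homFam s)) {A B : FinMatrix I D}
    (hA : A ∈ matrixComp 𝓓 (homFam s) (idArr a)) (hB : B ∈ matrixComp 𝓓 (homFam s) (idArr a)) :
    A * B ∈ matrixComp 𝓓 (homFam s) (idArr a) := by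
  have := matrixComp_mul_mem hσ hA hB
  rwa [Category.comp_id] at this

/-- `E_kk W E_kk = W_kk E_kk`. -/
theorem eq_finSingle_of_corner (hD : 𝓓.SupportedAt e) {k : I} {W : FinMatrix I D}
    (h1 : finSingle k k (𝓓.one e) * W = W) (h2 : W * finSingle k k (𝓓.one e) = W) :
    finSingle k k ((W : Matrix I I D) k k) = W := by
  have h := finSingle_mul_mul_finSingle k k k k (𝓓.one e) (𝓓.one e) W
  rw [h1, h2, hD.one_mul, hD.mul_one] at h
  exact h.symm

/-- The image of the idempotent `E_ii` under a graded isomorphism is equivalent to some `E_kk`,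
by means of elements whose degree is an object. -/
theorem exists_idempotent_equiv (hdiv : 𝓓.IsGrDivision) (hdiv' : 𝓓'.IsGrDivision)
    (hD : 𝓓.SupportedAt e) (hD' : 𝓓'.SupportedAt e') (hσ : DFinite (homFam s))
    (hδ : DFinite (homFam s')) (Φ : FinMatrix I D ≃+* FinMatrix I' D')
    (hΦ : ∀ γ A, A ∈ matrixComp 𝓓 (homFam s) γ ↔ Φ A ∈ matrixComp 𝓓' (homFam s') γ) (i : I) :
    ∃ (k : I') (P Q : FinMatrix I' D'), x' k = x i ∧
      P ∈ matrixComp 𝓓' (homFam s') (idArr (x i)) ∧ Q ∈ matrixComp 𝓓' (homFam s') (idArr (x i)) ∧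
      P * Q = Φ (finSingle i i (𝓓.one e)) ∧ Q * P = finSingle k k (𝓓'.one e') ∧
      P * finSingle k k (𝓓'.one e') = P ∧ finSingle k k (𝓓'.one e') * Q = Q := by
  classical
  set E := finSingle i i (𝓓.one e) with hE
  set f := Φ E with hf
  have hEE : E * E = E := by rw [hE, finSingle_mul_finSingle, hD.one_mul]
  have hff : f * f = f := by rw [hf, ← map_mul, hEE]
  have hfmem : f ∈ matrixComp 𝓓' (homFam s') (idArr (x i)) :=
    (hΦ _ _).1 (finSingle_one_mem_id i)
  have hf0 : f ≠ 0 := by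
    intro h
    have h1 : E = 0 := by simpa [hf] using h
    apply hdiv.one_ne_zero hD
    rw [← finSingle_same i i (𝓓.one e), ← hE, h1, finMatrix_zero_apply]
  obtain ⟨l, m, hlm⟩ : ∃ l m, (f : Matrix I' I' D') l m ≠ 0 := by
    by_contra! h'
    exact hf0 (finMatrix_ext h')
  -- As `f = f²`, a nonzero entry of `f` comes from a nonzero product `f_lk f_km`; this selects `k`
  -- with `f E_kk f ≠ 0`.
  obtain ⟨k, hk⟩ : ∃ k, (f : Matrix I' I' D') l k * (f : Matrix I' I' D') k m ≠ 0 := by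
    rw [← hff, finMatrix_mul_apply] at hlm
    exact exists_of_finsum_ne_zero hlm
  have hxk : x' k = x i := by
    obtain ⟨α, -, h⟩ := mem_matrixComp_homFam.1 hfmem l k (left_ne_zero_of_mul hk)
    exact (congrArg Arr.d h).symm
  set F := finSingle k k (𝓓'.one e') with hF
  have hFF : F * F = F := by rw [hF, finSingle_mul_finSingle, hD'.one_mul]
  set A := Φ.symm F with hA
  have hΦA : Φ A = F := Φ.apply_symm_apply F
  have hAA : A * A = A := Φ.injective (by rw [map_mul, hΦA, hFF])
  have hAmem : A ∈ matrixComp 𝓓 (homFam s) (idArr (x i)) := by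
    rw [hΦ, hΦA, ← hxk]
    exact finSingle_one_mem_id k
  have hEAE : E * A * E = finSingle i i ((A : Matrix I I D) i i) := by
    rw [hE, finSingle_mul_mul_finSingle, hD.one_mul, hD.mul_one]
  -- Otherwise `EAE = 0`, and applying `Φ` gives `fFf = 0`, although its `(l, m)` entry is `f_lk
  -- f_km`.
  have ha0 : (A : Matrix I I D) i i ≠ 0 := by
    intro h
    rw [h, finSingle_zero] at hEAE
    have h1 : f * F * f = 0 := by rw [hf, ← hΦA, ← map_mul, ← map_mul, hEAE, map_zero]
    apply hk
    rw [← finMatrix_zero_apply l m, ← h1, finMatrix_mul_apply, finsum_eq_single _ k,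
      mul_finSingle_apply, if_pos rfl, hD'.mul_one]
    intro n hn
    rw [mul_finSingle_apply, if_neg hn, zero_mul]
  have hAid : (A : Matrix I I D) i i ∈ 𝓓.comp (idArr e) := by
    obtain ⟨α, hα, h⟩ := mem_matrixComp_homFam.1 hAmem i i ha0
    have h1 : 𝟙 (x i) = s i ≫ α ≫ Groupoid.inv (s i) := by injection h
    have h2 : α = 𝟙 e := by
      have := congrArg (fun g => Groupoid.inv (s i) ≫ g ≫ s i) h1
      simpa using this.symm
    rwa [h2] at hα
  obtain ⟨b, hb, hab, -⟩ := hdiv.exists_inv_id hAid ha0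
  have hbmem : finSingle i i b ∈ matrixComp 𝓓 (homFam s) (idArr (x i)) := by
    have := finSingle_mem_matrixComp (𝓓 := 𝓓) (s := s) i i (α := 𝟙 e) hb
    rwa [Category.id_comp, Groupoid.comp_inv] at this
  set B := finSingle i i b with hB
  have hEB : E * B = B := by rw [hE, hB, finSingle_mul_finSingle, hD.one_mul]
  have hBE : B * E = B := by rw [hE, hB, finSingle_mul_finSingle, hD.mul_one]
  -- With `b = a_ii⁻¹`, the factors `EA` and `AB` multiply to `E`; their images are `P` and `Q`.
  have hEAB : E * A * B = E := by
    rw [← hEB, ← mul_assoc, hEAE, hB, finSingle_mul_finSingle, hab]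
  have hPQ : E * A * (A * B) = E := by rw [mul_assoc, ← mul_assoc A A B, hAA, ← mul_assoc, hEAB]
  have hE0 : E ≠ 0 := fun h => hf0 (by rw [hf, h, map_zero])
  have hP : Φ (E * A) * F = Φ (E * A) := by rw [← hΦA, ← map_mul, mul_assoc, hAA]
  have hQ : F * Φ (A * B) = Φ (A * B) := by rw [← hΦA, ← map_mul, ← mul_assoc, hAA]
  have hPmem := (hΦ _ _).1 (matrixComp_mul_mem_idArr hσ (finSingle_one_mem_id (𝓓 := 𝓓) i) hAmem)
  have hQmem := (hΦ _ _).1 (matrixComp_mul_mem_idArr hσ hAmem hbmem)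
  refine ⟨k, Φ (E * A), Φ (A * B), hxk, hPmem, hQmem, by rw [← map_mul, hPQ], ?_, hP, hQ⟩
  have hZ : finSingle k k _ = Φ (A * B) * Φ (E * A) :=
    eq_finSingle_of_corner hD' (k := k) (W := Φ (A * B) * Φ (E * A))
      (by rw [← mul_assoc, ← hF, hQ]) (by rw [mul_assoc, ← hF, hP])
  set z := ((Φ (A * B) * Φ (E * A) : FinMatrix I' D') : Matrix I' I' D') k k with hz
  -- `QP` lies in the corner of `E_kk`, so it is determined by `z`. It is idempotent because `PQ` is
  -- the identity of the corner of `f`.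
  have hzz : z * z = z := by
    apply finSingle_injective k k
    rw [← finSingle_mul_finSingle k k k, hZ, ← map_mul, ← map_mul]
    congr 1
    calc A * B * (E * A) * (A * B * (E * A)) = A * B * (E * A * (A * B)) * (E * A) := by
          simp only [mul_assoc]
      _ = A * B * (E * A) := by rw [hPQ, mul_assoc A B E, hBE]
  have hz0 : z ≠ 0 := by
    intro h
    rw [h, finSingle_zero, ← map_mul] at hZ
    have h1 : A * B * (E * A) = 0 :=
      Φ.injective (by rw [map_zero, hZ])
    apply hE0
    calc E = E * A * (A * B) * (E * A * (A * B)) := by rw [hPQ, hEE]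
      _ = E * A * (A * B * (E * A)) * (A * B) := by simp only [mul_assoc]
      _ = 0 := by rw [h1, mul_zero, zero_mul]
  obtain ⟨α, hα, -⟩ := mem_matrixComp_homFam.1 (matrixComp_mul_mem_idArr
    hδ hQmem hPmem) k k hz0
  obtain ⟨w, -, hzw, -⟩ := hdiv'.exists_inv hα hz0
  rw [← hZ]
  congr 1
  -- A nonzero homogeneous idempotent of a graded division ring is the identity.
  calc z = z * (z * w) := by rw [hzw, hD'.mul_one]
    _ = 𝓓'.one e' := by rw [← mul_assoc, hzz, hzw]

end Necessity

end GroupoidGraded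

namespace GroupoidGraded

/-! ### Corner isomorphism and the resulting matching -/

section Necessity

variable {C : Type*} [Groupoid C] {D D' I I' : Type*} [NonUnitalRing D] [NonUnitalRing D'] {e e' : C}
  {𝓓 : GroupoidGrading C D} {𝓓' : GroupoidGrading C D'}
  {x : I → C} {s : ∀ i, x i ⟶ e} {x' : I' → C} {s' : ∀ i, x' i ⟶ e'}

/-- Equal degrees in the two corners force `β = τατ⁻¹` for `τ = gf⁻¹`; `eqToHom` bridges the objects
`r'` and `r`, which agree only propositionally. -/
theorem arr_conj_unique {r r' : C} (h : r' = r) (f : r ⟶ e) (g : r' ⟶ e') {α : e ⟶ e}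
    {β : e' ⟶ e'} (H : (⟨r, r, f ≫ α ≫ Groupoid.inv f⟩ : Arr C)
      = ⟨r', r', g ≫ β ≫ Groupoid.inv g⟩) :
    β = Groupoid.inv (Groupoid.inv f ≫ eqToHom h.symm ≫ g) ≫ α ≫
      Groupoid.inv f ≫ eqToHom h.symm ≫ g := by
  subst h
  have h1 : f ≫ α ≫ Groupoid.inv f = g ≫ β ≫ Groupoid.inv g := by injection H
  have h2 := congrArg (fun w => Groupoid.inv g ≫ w ≫ g) h1
  simpa using h2.symm

/-- Reads the degree of an entry `X i l` as the coset relation `αδ_l = τσ_i`; `arr_col_eq` does the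
same for `Y l i`. -/
theorem arr_row_eq {r r' p q : C} (h : r' = r) (f : r ⟶ e) (a : p ⟶ e) (g : r' ⟶ e') (b : q ⟶ e')
    {α : e' ⟶ e'} (H : (⟨p, r, a ≫ Groupoid.inv f⟩ : Arr C) = ⟨q, r', b ≫ α ≫ Groupoid.inv g⟩) :
    (⟨q, e', b ≫ α⟩ : Arr C) = ⟨p, e', a ≫ Groupoid.inv f ≫ eqToHom h.symm ≫ g⟩ := by
  subst h
  obtain rfl : p = q := by injection H
  have h1 : a ≫ Groupoid.inv f = b ≫ α ≫ Groupoid.inv g := by injection H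
  have h2 := congrArg (fun w => w ≫ g) h1
  congr 1
  simpa using h2.symm

theorem arr_col_eq {r r' p q : C} (h : r' = r) (f : r ⟶ e) (a : p ⟶ e) (g : r' ⟶ e') (b : q ⟶ e')
    {α : e' ⟶ e'} (H : (⟨r, p, f ≫ Groupoid.inv a⟩ : Arr C) = ⟨r', q, g ≫ α ≫ Groupoid.inv b⟩) :
    (⟨p, e', (a ≫ Groupoid.inv f ≫ eqToHom h.symm ≫ g) ≫ α⟩ : Arr C) = ⟨q, e', b⟩ := by
  subst h
  obtain rfl : p = q := by injection H
  have h1 : f ≫ Groupoid.inv a = g ≫ α ≫ Groupoid.inv b := by injection H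
  have h2 := congrArg (fun w => a ≫ Groupoid.inv f ≫ w ≫ b) h1
  congr 1
  simpa using h2.symm

/-- An equivalence between the images of `E_ii` and `E_kk` gives an isomorphism of the corner rings
`E_ii M_I(D) E_ii = D` and `E_kk M_I'(D') E_kk = D'`. -/
theorem exists_corner_ringEquiv (hD : 𝓓.SupportedAt e) (hD' : 𝓓'.SupportedAt e')
    (Φ : FinMatrix I D ≃+* FinMatrix I' D') {i : I} {k : I'} {P Q : FinMatrix I' D'}
    (hPQ : P * Q = Φ (finSingle i i (𝓓.one e))) (hQP : Q * P = finSingle k k (𝓓'.one e'))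
    (hP : P * finSingle k k (𝓓'.one e') = P) (hQ : finSingle k k (𝓓'.one e') * Q = Q) :
    ∃ ψ : D ≃+* D', ∀ a, ψ a
      = ((Q * Φ (finSingle i i a) * P : FinMatrix I' D') : Matrix I' I' D') k k := by
  have hfP : Φ (finSingle i i (𝓓.one e)) * P = P := by rw [← hPQ, mul_assoc, hQP, hP]
  have hQf : Q * Φ (finSingle i i (𝓓.one e)) = Q := by rw [← hPQ, ← mul_assoc, hQP, hQ]
  have h1 : ∀ a, finSingle k k (((Q * Φ (finSingle i i a) * P : FinMatrix I' D') :
      Matrix I' I' D') k k) = Q * Φ (finSingle i i a) * P := fun a =>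
    eq_finSingle_of_corner hD' (by rw [← mul_assoc, ← mul_assoc, hQ]) (by rw [mul_assoc, hP])
  have h2 : ∀ b, finSingle i i (((Φ.symm (P * finSingle k k b * Q) : FinMatrix I D) :
      Matrix I I D) i i) = Φ.symm (P * finSingle k k b * Q) := fun b => by
    refine eq_finSingle_of_corner hD (Φ.injective ?_) (Φ.injective ?_)
    · rw [map_mul, Φ.apply_symm_apply, ← mul_assoc, ← mul_assoc, hfP]
    · rw [map_mul, Φ.apply_symm_apply, mul_assoc, hQf]
  -- The inner factor `PQ` is `Φ(E_ii)`, which acts as the identity on the images of the corner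
  -- elements.
  have h3 : ∀ a b, Q * Φ (finSingle i i a) * P * (Q * Φ (finSingle i i b) * P)
      = Q * Φ (finSingle i i (a * b)) * P := fun a b => by
    calc _ = Q * (Φ (finSingle i i a) * (P * Q) * Φ (finSingle i i b)) * P := by
          simp only [mul_assoc]
      _ = _ := by
        rw [hPQ, ← map_mul, ← map_mul, finSingle_mul_finSingle, finSingle_mul_finSingle, hD.mul_one]
  refine ⟨{
    toFun := fun a => ((Q * Φ (finSingle i i a) * P : FinMatrix I' D') : Matrix I' I' D') k k
    invFun := fun b => ((Φ.symm (P * finSingle k k b * Q) : FinMatrix I D) : Matrix I I D) i i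
    left_inv := fun a => finSingle_injective i i ?_
    right_inv := fun b => finSingle_injective k k ?_
    map_mul' := fun a b => finSingle_injective k k ?_
    map_add' := fun a b => ?_ }, fun a => rfl⟩
  · dsimp only
    rw [h2, h1]
    apply Φ.injective
    rw [Φ.apply_symm_apply]
    calc _ = (P * Q) * Φ (finSingle i i a) * (P * Q) := by simp only [mul_assoc]
      _ = _ := by
        rw [hPQ, ← map_mul, ← map_mul, finSingle_mul_finSingle, finSingle_mul_finSingle, hD.one_mul,
          hD.mul_one]
  · dsimp only
    rw [h1, h2, Φ.apply_symm_apply]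
    calc _ = (Q * P) * finSingle k k b * (Q * P) := by simp only [mul_assoc]
      _ = _ := by
        rw [hQP, finSingle_mul_finSingle, finSingle_mul_finSingle, hD'.one_mul, hD'.mul_one]
  · rw [h1, ← finSingle_mul_finSingle k k k, h1, h1, h3]
  · rw [finSingle_add, map_add, mul_add, add_mul]
    rfl

/-- All elements of one coset have the same domain, so `d`-finiteness bounds each class. -/
theorem finite_inCoset (hσ : DFinite (homFam s)) (t : e ⟶ e') (ρ : Arr C) :
    Finite {i // InCoset 𝓓' ρ (s i ≫ t)} :=
  Set.finite_coe_iff.2 ((hσ ρ.d).subset fun _ hi => InCoset.d_eq hi)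

theorem matrixOne_eq_sum (hσ : DFinite (homFam s)) (y : C) :
    matrixOne 𝓓 (homFam s) hσ y = ∑ i ∈ (hσ y).toFinset, finSingle i i (𝓓.one e) := by
  classical
  apply finMatrix_ext
  intro k l
  rw [finMatrix_sum_apply]
  change (if k = l ∧ x k = y then 𝓓.one e else 0) = _
  split_ifs with h
  · obtain ⟨rfl, h⟩ := h
    rw [Finset.sum_eq_single k, finSingle_same]
    · intro i _ hi
      rw [finSingle_apply, if_neg fun h => hi h.1.symm]
    · intro hk
      exact absurd ((hσ y).mem_toFinset.2 h) hk
  · refine (Finset.sum_eq_zero fun i hi => ?_).symm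
    rw [finSingle_apply, if_neg]
    rintro ⟨rfl, rfl⟩
    exact h ⟨rfl, (hσ y).mem_toFinset.1 hi⟩

/-- The corner isomorphism supplies `τ`. The image under `Φ` of the row and column of matrix units
through `i₀`, compressed by `Q` and `P`, supplies inverse matrices whose nonzero entries compare
`τσ_i` with `δ_l`. -/
theorem exists_equiv_of_grIso_fullMatrix [Nonempty I] (hdiv : 𝓓.IsGrDivision)
    (hdiv' : 𝓓'.IsGrDivision) (hD : 𝓓.SupportedAt e) (hD' : 𝓓'.SupportedAt e')
    (hσ : DFinite (homFam s)) (hδ : DFinite (homFam s'))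
    (h : (fullMatrix (𝓓 := 𝓓) hD hσ).GrIso (fullMatrix (𝓓 := 𝓓') hD' hδ)) :
    ∃ (π : I ≃ I') (t : e ⟶ e'), 𝓓'.GrIso (grMatrixOne 𝓓 (invArr ⟨e, e', t⟩)) ∧
      ∀ i, MemTranslate ⟨e, e', t⟩ 𝓓.supp (homFam s i) (homFam s' (π i)) := by
  classical
  obtain ⟨Φ, hΦ₀, hΦone⟩ := h
  have hΦ : ∀ γ A, A ∈ matrixComp 𝓓 (homFam s) γ ↔ Φ A ∈ matrixComp 𝓓' (homFam s') γ :=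
    fun γ A => ⟨hΦ₀ γ A, fun hA => by
      have h1 : Φ.symm (Φ A) ∈ (fullMatrix (𝓓 := 𝓓) hD hσ).comp γ :=
        GroupoidGrading.symm_mem_comp (𝓢 := fullMatrix (𝓓 := 𝓓') hD' hδ) Φ hΦ₀ hA
      rwa [Φ.symm_apply_apply] at h1⟩
  obtain ⟨i₀⟩ := ‹Nonempty I›
  obtain ⟨k, P, Q, hk, hPmem, hQmem, hPQ, hQP, hP, hQ⟩ :=
    exists_idempotent_equiv hdiv hdiv' hD hD' hσ hδ Φ hΦ i₀
  obtain ⟨ψ, hψ⟩ := exists_corner_ringEquiv hD hD' Φ hPQ hQP hP hQ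
  set t : e ⟶ e' := Groupoid.inv (s i₀) ≫ eqToHom hk.symm ≫ s' k with ht
  have hiso : 𝓓'.GrIso (grMatrixOne 𝓓 (invArr ⟨e, e', t⟩)) := by
    refine grIso_grMatrixOne hD t ψ fun α a ha => ?_
    by_cases h0 : ψ a = 0
    · rw [h0]
      exact zero_mem _
    · have h1 := matrixComp_mul_mem hδ (matrixComp_mul_mem hδ hQmem
        ((hΦ _ _).1 (finSingle_mem_matrixComp i₀ i₀ ha))) hPmem
      rw [hψ] at h0 ⊢
      obtain ⟨β, hβ, h2⟩ := mem_matrixComp_homFam.1 h1 k k h0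
      rw [Category.id_comp, Category.comp_id] at h2
      rwa [← arr_conj_unique hk _ _ h2]
  let X : I → I' → D' := fun i l =>
    ((Q * Φ (finSingle i₀ i (𝓓.one e)) : FinMatrix I' D') : Matrix I' I' D') k l
  let Y : I' → I → D' := fun l i =>
    ((Φ (finSingle i i₀ (𝓓.one e)) * P : FinMatrix I' D') : Matrix I' I' D') l k
  have hX : ∀ i l, X i l ≠ 0 → ∃ α : e' ⟶ e', X i l ∈ 𝓓'.comp ⟨e', e', α⟩ ∧
      (⟨x' l, e', s' l ≫ α⟩ : Arr C) = ⟨x i, e', s i ≫ t⟩ := by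
    intro i l h0
    obtain ⟨α, hα, h1⟩ := mem_matrixComp_homFam.1 (matrixComp_mul_mem hδ hQmem
      ((hΦ _ _).1 (finSingle_one_mem i₀ i))) k l h0
    rw [Category.comp_id] at h1
    exact ⟨α, hα, arr_row_eq hk _ _ _ _ h1⟩
  have hY : ∀ l i, Y l i ≠ 0 → ∃ α : e' ⟶ e', Y l i ∈ 𝓓'.comp ⟨e', e', α⟩ ∧
      (⟨x i, e', (s i ≫ t) ≫ α⟩ : Arr C) = ⟨x' l, e', s' l⟩ := by
    intro l i h0
    obtain ⟨α, hα, h1⟩ := mem_matrixComp_homFam.1 (matrixComp_mul_mem hδ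
      ((hΦ _ _).1 (finSingle_one_mem i i₀)) hPmem) l k h0
    rw [Category.id_comp] at h1
    exact ⟨α, hα, arr_col_eq hk _ _ _ _ h1⟩
  have hXYprod : ∀ i i', ∑ᶠ l, X i l * Y l i' = ((Q * Φ (finSingle i₀ i (𝓓.one e) *
      finSingle i' i₀ (𝓓.one e)) * P : FinMatrix I' D') : Matrix I' I' D') k k := by
    intro i i'
    rw [map_mul, mul_assoc Q, mul_assoc, ← mul_assoc, finMatrix_mul_apply]
  have hXY : ∀ i, ∑ᶠ l, X i l * Y l i = 𝓓'.one e' := by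
    intro i
    rw [hXYprod, finSingle_mul_finSingle, hD.one_mul, ← hPQ, ← mul_assoc, hQP, hQ, hQP,
      finSingle_same]
  have hXY' : ∀ i i', i ≠ i' → ∑ᶠ l, X i l * Y l i' = 0 := by
    intro i i' hi
    rw [hXYprod, finSingle_mul_finSingle_of_ne hi, map_zero, mul_zero, zero_mul,
      finMatrix_zero_apply]
  have hYXprod : ∀ l l' i, Y l i * X i l'
      = (Φ (finSingle i i (𝓓.one e)) : Matrix I' I' D') l l' := by
    intro l l' i
    have h1 : Φ (finSingle i i (𝓓.one e)) = Φ (finSingle i i₀ (𝓓.one e)) * P *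
        (Q * Φ (finSingle i₀ i (𝓓.one e))) := by
      rw [mul_assoc, ← mul_assoc P, hPQ, ← map_mul, ← map_mul, finSingle_mul_finSingle,
        finSingle_mul_finSingle, hD.one_mul, hD.one_mul]
    rw [h1, finMatrix_mul_apply, finsum_eq_single _ k]
    -- Only column `k` of `P` is nonzero, because `P E_kk = P`.
    intro m hm
    rw [← hP, ← mul_assoc, mul_finSingle_apply, if_neg hm, zero_mul]
  -- Degrees restrict the sum to the `i` with `d(σ_i) = d(δ_l)`, where the `Φ(E_ii)` add up to the
  -- image of the local identity at `d(δ_l)`, which `Φ` preserves.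
  have hYXsum : ∀ l l', ∑ᶠ i, Y l i * X i l' = (matrixOne 𝓓' (homFam s') hδ (x' l) :
      Matrix I' I' D') l l' := by
    intro l l'
    have h1 : Φ (matrixOne 𝓓 (homFam s) hσ (x' l)) = matrixOne 𝓓' (homFam s') hδ (x' l) :=
      hΦone (x' l)
    rw [← h1, matrixOne_eq_sum, map_sum, finMatrix_sum_apply]
    simp only [hYXprod]
    apply finsum_eq_sum_of_support_subset
    intro i hi
    obtain ⟨α, -, h2⟩ := mem_matrixComp_homFam.1 ((hΦ _ _).1
      (finSingle_one_mem_id (𝓓 := 𝓓) (s := s) i)) l l' hi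
    rw [Set.Finite.coe_toFinset]
    exact congrArg Arr.r h2
  have hYX : ∀ l, ∑ᶠ i, Y l i * X i l = 𝓓'.one e' := by
    intro l
    rw [hYXsum]
    exact if_pos ⟨rfl, rfl⟩
  have hYX' : ∀ l l', l ≠ l' → ∑ᶠ i, Y l i * X i l' = 0 := by
    intro l l' hl
    rw [hYXsum]
    exact if_neg fun h => hl h.1
  have hfin : ∀ ρ, Finite {i // InCoset 𝓓' ρ (s i ≫ t)} := finite_inCoset hσ t
  have hfin' : ∀ ρ, Finite {l // InCoset 𝓓' ρ (s' l)} := fun ρ => by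
    simpa only [Category.comp_id] using finite_inCoset (𝓓' := 𝓓') hδ (𝟙 e') ρ
  obtain ⟨π, hπ⟩ := exists_equiv_inCoset hdiv' hD' (fun i => s i ≫ t) s' fun ρ =>
    le_antisymm (card_inCoset_le hdiv' hD' (fun i => s i ≫ t) s' X Y hX hY hXY hXY' ρ)
      (card_inCoset_le hdiv' hD' s' (fun i => s i ≫ t) Y X hY hX hYX hYX' ρ)
  refine ⟨π, t, hiso, fun i => (memTranslate_supp_iff hD t _ _).2 ?_⟩
  -- The matching obtained is `δ_{π(i)} ∈ (supp D')τσ_i`; since `D'` is `D` with degrees conjugated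
  -- by `τ`, `(supp D')τ = τ(supp D)`.
  obtain ⟨ψ', hψ'⟩ := exists_ringEquiv_of_grIso_grMatrixOne hD t hiso
  obtain ⟨β, hβ, h1⟩ := hπ i
  obtain ⟨b, hb, hb0⟩ := exists_mem_ne_zero hβ
  refine ⟨t ≫ β ≫ Groupoid.inv t, comp_ne_bot (a := ψ'.symm b) ((hψ' _ _).1 ?_)
    (by simpa using hb0), ?_⟩
  · rw [ψ'.apply_symm_apply]
    simpa using hb
  · rw [h1]
    simp

end Necessity

/-! ### The isomorphism theorems -/

section Main

variable {C : Type*} [Groupoid C]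

/-- The isomorphism theorem for graded matrix rings over graded division rings. -/
theorem grMatrix_grIso_iff {D D' I I' : Type*} [NonUnitalRing D] [NonUnitalRing D']
    {𝓓 : GroupoidGrading C D} {𝓓' : GroupoidGrading C D'} {e e' : C} [Nonempty I]
    {σ : I → Arr C} {δ : I' → Arr C} (hσ : DFinite σ) (hδ : DFinite δ)
    (hdiv : 𝓓.IsGrDivision) (hdiv' : 𝓓'.IsGrDivision) (hD : 𝓓.SupportedAt e)
    (hD' : 𝓓'.SupportedAt e') (hσr : ∀ i, (σ i).r = e) (hδr : ∀ i, (δ i).r = e') :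
    (grMatrix 𝓓 σ hσ).GrIso (grMatrix 𝓓' δ hδ) ↔
      ∃ (π : I ≃ I') (τ : Arr C), τ.r = e' ∧ τ.d = e ∧
        𝓓'.GrIso (grMatrixOne 𝓓 (invArr τ)) ∧
        ∀ i, MemTranslate τ 𝓓.supp (σ i) (δ (π i)) := by
  obtain ⟨x, s, rfl⟩ := exists_eq_homFam hσr
  obtain ⟨x', s', rfl⟩ := exists_eq_homFam hδr
  constructor
  · intro h
    obtain ⟨π, t, h1, h2⟩ := exists_equiv_of_grIso_fullMatrix hdiv hdiv' hD hD' hσ hδ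
      (((grMatrix_grIso_fullMatrix hD hσ).symm.trans h).trans (grMatrix_grIso_fullMatrix hD' hδ))
    exact ⟨π, ⟨e, e', t⟩, rfl, rfl, h1, h2⟩
  · rintro ⟨π, ⟨a, b, t⟩, h1, h2, h3, h4⟩
    dsimp only at h1 h2
    subst h1 h2
    exact grIso_grMatrix_of_memTranslate hdiv hD hD' hσ hδ π t h3 h4

end Main

end GroupoidGraded

theorem mainTheorem8 {C : Type*} [Groupoid C] :
    -- the isomorphism theorem for graded matrix rings over graded division rings
    (∀ {D : Type*} {D' : Type*} [NonUnitalRing D] [NonUnitalRing D']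
        (𝓓 : GroupoidGrading C D) (𝓓' : GroupoidGrading C D') (e e' : C)
        {I : Type*} {I' : Type*} [Nonempty I] [Nonempty I']
        (σ : I → Arr C) (δ : I' → Arr C) (hσ : DFinite σ) (hδ : DFinite δ),
        𝓓.IsGrDivision → 𝓓'.IsGrDivision → 𝓓.SupportedAt e → 𝓓'.SupportedAt e' →
        (∀ i, (σ i).r = e) → (∀ i, (δ i).r = e') →
        ((grMatrix 𝓓 σ hσ).GrIso (grMatrix 𝓓' δ hδ) ↔
          ∃ (π : I ≃ I') (τ : Arr C), τ.r = e' ∧ τ.d = e ∧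
            𝓓'.GrIso (grMatrixOne 𝓓 (invArr τ)) ∧
            ∀ i, MemTranslate τ 𝓓.supp (σ i) (δ (π i)))) ∧
    -- uniqueness of graded products of summable families of gr-simple rings
    (∀ {J : Type*} {J' : Type*} {R : J → Type*} {T : J' → Type*}
        [∀ j, NonUnitalRing (R j)] [∀ j, NonUnitalRing (T j)]
        (𝓡 : ∀ j, GroupoidGrading C (R j)) (𝓣 : ∀ j, GroupoidGrading C (T j)),
        IsSummable 𝓡 → IsSummable 𝓣 → (∀ j, (𝓡 j).IsGrSimple) → (∀ j, (𝓣 j).IsGrSimple) →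
        ((grProd 𝓡).GrIso (grProd 𝓣) ↔ ∃ π : J ≃ J', ∀ j, (𝓡 j).GrIso (𝓣 (π j)))) ∧
    -- uniqueness of the Wedderburn-Artin decomposition
    (∀ {J : Type*} {J' : Type*} {D : J → Type*} {D' : J' → Type*}
        [∀ j, NonUnitalRing (D j)] [∀ j, NonUnitalRing (D' j)]
        (𝓓 : ∀ j, GroupoidGrading C (D j)) (𝓓' : ∀ j, GroupoidGrading C (D' j))
        (e : J → C) (e' : J' → C)
        {K : J → Type*} {K' : J' → Type*} [∀ j, Nonempty (K j)] [∀ j, Nonempty (K' j)]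
        (σ : ∀ j, K j → Arr C) (δ : ∀ j, K' j → Arr C)
        (hσ : ∀ j, DFinite (σ j)) (hδ : ∀ j, DFinite (δ j)),
        (∀ j, (𝓓 j).IsGrDivision) → (∀ j, (𝓓' j).IsGrDivision) →
        (∀ j, (𝓓 j).SupportedAt (e j)) → (∀ j, (𝓓' j).SupportedAt (e' j)) →
        (∀ j k, (σ j k).r = e j) → (∀ j k, (δ j k).r = e' j) →
        IsSummable (fun j => grMatrix (𝓓 j) (σ j) (hσ j)) →
        IsSummable (fun j => grMatrix (𝓓' j) (δ j) (hδ j)) →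
        ((grProd fun j => grMatrix (𝓓 j) (σ j) (hσ j)).GrIso
            (grProd fun j => grMatrix (𝓓' j) (δ j) (hδ j)) ↔
          ∃ π : J ≃ J', ∀ j, ∃ (ϖ : K j ≃ K' (π j)) (τ : Arr C),
            τ.r = e' (π j) ∧ τ.d = e j ∧
            (𝓓' (π j)).GrIso (grMatrixOne (𝓓 j) (invArr τ)) ∧
            ∀ k, MemTranslate τ (𝓓 j).supp (σ j k) (δ (π j) (ϖ k)))) := by

  refine ⟨?_, ?_, ?_⟩
  · intro D D' _ _ 𝓓 𝓓' e e' I I' _ _ σ δ hσ hδ hdiv hdiv' hD hD' hσr hδr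
    exact grMatrix_grIso_iff hσ hδ hdiv hdiv' hD hD' hσr hδr
  · intro J J' R T _ _ 𝓡 𝓣 _ _ h𝓡 h𝓣
    exact ⟨exists_equiv_of_grProd_grIso h𝓡 h𝓣, fun ⟨π, h⟩ => grProd_grIso_of_equiv 𝓡 𝓣 π h⟩
  · intro J J' D D' _ _ 𝓓 𝓓' e e' K K' _ _ σ δ hσ hδ hdiv hdiv' hD hD' hσr hδr _ _
    have key := fun j j' => grMatrix_grIso_iff (hσ j) (hδ j') (hdiv j) (hdiv' j') (hD j) (hD' j')
      (hσr j) (hδr j')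
    constructor
    · intro h
      obtain ⟨π, hπ⟩ := exists_equiv_of_grProd_grIso
        (fun j => isGrSimple_grMatrix (hdiv j) (hD j) (hσr j) (hσ j))
        (fun j => isGrSimple_grMatrix (hdiv' j) (hD' j) (hδr j) (hδ j)) h
      exact ⟨π, fun j => (key j (π j)).1 (hπ j)⟩
    · rintro ⟨π, hπ⟩
      exact grProd_grIso_of_equiv _ _ π fun j => (key j (π j)).2 (hπ j)
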